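/- All vector spaces are over $\mathbb C$, and $\delta(z)=\sum_{m\in\mathbb Z}z^m$. For every integer $m$, an expression $(\pm x\pm y)^m$ is expanded in nonnegative powers of the second summand $y$, and $g(\pm x\pm y)=\sum_m g_m(\pm x\pm y)^m$ for $g(x)=\sum_m g_mx^m$. A substitution $A(x_1,x_2)|_{x_1=x+y}$ likewise expands the powers of $x+y$ in nonnegative powers of $y$. Denote by $\iota_{x,0}:\mathbb C(x)\to\mathbb C((x))$ and $\iota_{x,\infty}:\mathbb C(x)\to\mathbb C((x^{-1}))$ the expansions of rational functions at $x=0$ and at $x=\infty$. A nonlocal vertex algebra is a vector space $V$ with a vector $\mathbf 1\in V$ and a linear map $Y:V\to\mathrm{Hom}(V,V((x)))$ such that, for all $u,v,w\in V$: $Y(\mathbf 1,x)v=v$; $Y(v,x)\mathbf 1\in V[[x]]$ has constant term $v$; and there is an integer $l\ge 0$ with $(x_0+x_2)^lY(u,x_0+x_2)Y(v,x_2)w=(x_0+x_2)^lY(Y(u,x_0)v,x_2)w$. A $V$-module-at-infinity is a vector space $W$ with a linear map $Y_W:V\to\mathrm{Hom}(W,W((x^{-1})))$ such that $Y_W(\mathbf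 1,x)=1_W$ and for all $u,v\in V$ there is an integer $k\ge 0$ with $$(x_1-x_2)^kY_W(u,x_1)Y_W(v,x_2)\in\mathrm{Hom}(W,W((x_1^{-1},x_2^{-1})))$$ and $$x_0^kY_W(Y(u,x_0)v,x_2)=\left((x_1-x_2)^kY_W(u,x_1)Y_W(v,x_2)\right)|_{x_1=x_2+x_0}.$$ It is faithful if $Y_W$ is injective. **Proposition 4.5.** Let $V$ be a nonlocal vertex algebra, let $(W,Y_W)$ be a $V$-module-at-infinity, and let $n\in\mathbb Z$, $u,v,u^{(i)},v^{(i)}\in V$, $f_i(x)\in\mathbb C(x)$ $(i=1,\dots,r)$, and $c^{(0)},\dots,c^{(s)}\in V$. If $$(x_1-x_2)^nY(u,x_1)Y(v,x_2)-(-x_2+x_1)^n\sum_{i=1}^r\iota_{x,0}(f_i)(x_2-x_1)Y(v^{(i)},x_2)Y(u^{(i)},x_1)=\sum_{j=0}^sY(c^{(j)},x_2)\frac1{j!}\left(\frac{\partial}{\partial x_2}\right)^jx_1^{-1}\delta\left(\frac{x_2}{x_1}\right)$$ on $V$, then $$(x_1-x_2)^n\sum_{i=1}^r\iota_{x,\infty}(f_i)(-x_1+x_2)Y_W(v^{(i)},x_2)Y_W(u^{(i)},x_1)-(-x_2+x_1)^nY_W(u,x_1)Y_W(v,x_2)=\sum_{j=0}^sY_W(c^{(j)},x_2)\frac1{j!}\left(\frac{\partial}{\partial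 x_2}\right)^jx_1^{-1}\delta\left(\frac{x_2}{x_1}\right)$$ on $W$. If $(W,Y_W)$ is faithful, the converse is also true. -/

import Mathlib

noncomputable section

namespace NLVA

/-! ### Formal calculus

A formal series `∑ aₙ xⁿ` (infinite in both directions) with coefficients in `E` is the function
`n ↦ aₙ` from `ℤ` to `E`; a formal series `∑ S a b x₁^a x₂^b` in two variables is
`S : ℤ → ℤ → E`, the exponent of the first-named variable coming first. -/

/-- Product of a scalar formal series `g` in two variables with a vector valued one, by the Cauchy
rule. It is only meaningful where each coefficient is a finite sum, which is the case at every
place where it is used below. -/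
def fmul {E : Type*} [AddCommGroup E] [Module ℂ E] (g : ℤ → ℤ → ℂ) (S : ℤ → ℤ → E) : ℤ → ℤ → E :=
  fun a b => ∑ᶠ p : ℤ × ℤ, g p.1 p.2 • S (a - p.1) (b - p.2)

/-- `(α x + β y)^n = ∑_{i ≥ 0} (n choose i) α^(n-i) β^i x^(n-i) y^i`, for any integer `n`: the
binomial convention, in nonnegative powers of the second summand. The value at `a`, `b` is the
coefficient of `x^a y^b`. -/
def binomPow (α β : ℂ) (n : ℤ) : ℤ → ℤ → ℂ :=
  fun a b => if 0 ≤ b ∧ a + b = n then (Ring.choose n b.toNat : ℤ) * α ^ a * β ^ b else 0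

/-- `g(α x + β y) = ∑ₙ gₙ (α x + β y)^n`, with the binomial convention. Only `n = a + b`
contributes to the coefficient of `x^a y^b`. -/
def binomSubst (g : ℤ → ℂ) (α β : ℂ) : ℤ → ℤ → ℂ :=
  fun a b => g (a + b) * binomPow α β (a + b) a b

/-- Exchange of the order of the two variables of a series: `(x, y)` instead of `(y, x)`. -/
def swapVars {E : Type*} (S : ℤ → ℤ → E) : ℤ → ℤ → E := fun a b => S b a

/-- A series in `x₂` alone, as a series in `x₁`, `x₂`. -/
def constFst {E : Type*} [Zero E] (g : ℤ → E) : ℤ → ℤ → E := fun a b => if a = 0 then g b else 0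

/-- `∂/∂x₂` on series in `x₁`, `x₂`. -/
def derivSnd (S : ℤ → ℤ → ℂ) : ℤ → ℤ → ℂ := fun a b => ((b + 1 : ℤ) : ℂ) * S a (b + 1)

/-- `x₁⁻¹ δ(x₂/x₁) = ∑ₙ x₁^(-n-1) x₂^n`. -/
def delta : ℤ → ℤ → ℂ := fun a b => if a = -b - 1 then 1 else 0

/-- `(1/j!) (∂/∂x₂)^j x₁⁻¹ δ(x₂/x₁)`. -/
def deltaDeriv (j : ℕ) : ℤ → ℤ → ℂ := fun a b => (j.factorial : ℂ)⁻¹ * (derivSnd^[j] delta) a b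

/-- Given `S(x₁, x₂)`, the series `S(x₀ + x₂, x₂)` in `x₀`, `x₂`, where the powers of `x₀ + x₂` are
expanded in nonnegative powers of `x₂`. Finite sums for `S ∈ E((x₁))((x₂))`. -/
def substFst {E : Type*} [AddCommGroup E] (S : ℤ → ℤ → E) : ℤ → ℤ → E :=
  fun a b => ∑ᶠ i : ℕ, (Ring.choose (a + i) i : ℤ) • S (a + i) (b - i)

/-- Given `S(x₁, x₂)`, the series `S(x₁, x₂)|_{x₁ = x₂ + x₀}` in `x₀`, `x₂`, where the powers of
`x₂ + x₀` are expanded in nonnegative powers of `x₀`. Finite sums for `S ∈ E((x₁⁻¹, x₂⁻¹))`. -/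
def substTaylor {E : Type*} [AddCommGroup E] (S : ℤ → ℤ → E) : ℤ → ℤ → E :=
  fun a b => if 0 ≤ a then ∑ᶠ n : ℤ, (Ring.choose n a.toNat : ℤ) • S n (b + a - n) else 0

/-- `S ∈ E((x₁⁻¹, x₂⁻¹))`: the exponents of both variables are jointly bounded above. -/
def BoundedAbove {E : Type*} [Zero E] (S : ℤ → ℤ → E) : Prop :=
  ∃ N : ℤ, ∀ a b : ℤ, (N < a ∨ N < b) → S a b = 0

/-! ### Expansions of rational functions -/

/-- Evaluation `ℂ[x] → ℂ((x⁻¹))`; here `ℂ((x⁻¹))` is the field of Hahn series whose exponents form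
a set that is well-ordered for the reversed order of `ℤ`. -/
def polyAtInfty : Polynomial ℂ →+* HahnSeries ℤᵒᵈ ℂ :=
  Polynomial.eval₂RingHom HahnSeries.C (HahnSeries.single (OrderDual.toDual (1 : ℤ)) 1)

theorem polyAtInfty_coeff (p : Polynomial ℂ) (n : ℕ) :
    (polyAtInfty p).coeff (OrderDual.toDual (n : ℤ)) = p.coeff n := by
  induction p using Polynomial.induction_on' with
  | add p q hp hq => rw [map_add, HahnSeries.coeff_add, hp, hq, Polynomial.coeff_add]
  | monomial m c =>
    have h : (m • OrderDual.toDual (1 : ℤ)) = OrderDual.toDual (m : ℤ) := by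
      change OrderDual.toDual (m • (1 : ℤ)) = _
      simp
    simp only [polyAtInfty, Polynomial.coe_eval₂RingHom, Polynomial.eval₂_monomial,
      HahnSeries.single_pow, h, one_pow, HahnSeries.C_mul_eq_smul, HahnSeries.coeff_smul,
      HahnSeries.coeff_single, Polynomial.coeff_monomial, OrderDual.toDual_inj, Nat.cast_inj]
    by_cases hmn : m = n
    · simp [hmn]
    · rw [if_neg (fun h => hmn h.symm), if_neg hmn, smul_zero]

theorem polyAtInfty_injective : Function.Injective polyAtInfty := by
  intro p q h
  ext n
  rw [← polyAtInfty_coeff, ← polyAtInfty_coeff, h]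

/-- The field embedding `ι_{x,∞} : ℂ(x) → ℂ((x⁻¹))`. -/
def iotaInfty : RatFunc ℂ →+* HahnSeries ℤᵒᵈ ℂ :=
  RatFunc.liftRingHom polyAtInfty
    (nonZeroDivisors_le_comap_nonZeroDivisors_of_injective _ polyAtInfty_injective)

/-- The coefficients of `ι_{x,∞}(f)`. -/
def atInfty (f : RatFunc ℂ) : ℤ → ℂ := fun n => (iotaInfty f).coeff (OrderDual.toDual n)

/-- The coefficients of `ι_{x,0}(f)`, the Laurent series of `f` at `x = 0`. -/
def atZero (f : RatFunc ℂ) : ℤ → ℂ := fun n => (f : LaurentSeries ℂ).coeff n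

/-! ### Vertex operators -/

/-- `A(x₁) B(x₂) w`, for fields `A`, `B` given by their coefficients. -/
def prod12 {E : Type*} [AddCommGroup E] [Module ℂ E] (A B : ℤ → Module.End ℂ E) (w : E) :
    ℤ → ℤ → E := fun a b => A a (B b w)

/-- `B(x₂) A(x₁) w`, for fields `A`, `B` given by their coefficients. -/
def prod21 {E : Type*} [AddCommGroup E] [Module ℂ E] (B A : ℤ → Module.End ℂ E) (w : E) :
    ℤ → ℤ → E := fun a b => B b (A a w)

/-- A nonlocal vertex algebra structure on `V`. Here `VertexOperator ℂ V` is `Hom(V, V((x)))`. -/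
structure NonlocalVertexAlgebra (V : Type*) [AddCommGroup V] [Module ℂ V] where
  /-- the vacuum vector -/
  vac : V
  /-- the map `v ↦ Y(v, x)` -/
  Y : V →ₗ[ℂ] VertexOperator ℂ V
  /-- `Y(1, x) v = v` -/
  vac_left : ∀ (n : ℤ) (v : V), (Y vac).coeff n v = if n = 0 then v else 0
  /-- `Y(v, x) 1 ∈ V[[x]]` -/
  creation : ∀ (v : V) (n : ℤ), n < 0 → (Y v).coeff n vac = 0
  /-- `lim_{x → 0} Y(v, x) 1 = v` -/
  creation_lim : ∀ v : V, (Y v).coeff 0 vac = v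
  /-- `(x₀ + x₂)^l Y(u, x₀ + x₂) Y(v, x₂) w = (x₀ + x₂)^l Y(Y(u, x₀) v, x₂) w` -/
  weak_assoc : ∀ u v w : V, ∃ l : ℕ,
    fmul (binomPow 1 1 l) (substFst (prod12 (Y u).coeff (Y v).coeff w)) =
      fmul (binomPow 1 1 l) (fun a b => (Y ((Y u).coeff a v)).coeff b w)

/-- `Hom(W, W((x⁻¹)))`. -/
abbrev OppField (W : Type*) [AddCommGroup W] [Module ℂ W] := HVertexOperator ℤᵒᵈ ℂ W W

/-- The coefficient of `x^n` in an element of `Hom(W, W((x⁻¹)))`. -/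
def OppField.modes {W : Type*} [AddCommGroup W] [Module ℂ W] (A : OppField W) :
    ℤ → Module.End ℂ W :=
  fun n => HVertexOperator.coeff A (OrderDual.toDual n)

/-- A (left) `V`-module-at-infinity structure on `W`. (The weaker defining condition of a quasi
module-at-infinity, with a nonzero polynomial `p(x₁, x₂)` in place of `(x₁ - x₂)^k`, is the
special case `p = (x₁ - x₂)^k` of the last field.) -/
structure ModuleAtInfinity {V : Type*} [AddCommGroup V] [Module ℂ V] (A : NonlocalVertexAlgebra V)
    (W : Type*) [AddCommGroup W] [Module ℂ W] where
  /-- the map `v ↦ Y_W(v, x)` -/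
  Y : V →ₗ[ℂ] OppField W
  /-- `Y_W(1, x) = 1` -/
  vac_left : ∀ (n : ℤ) (w : W), (Y A.vac).modes n w = if n = 0 then w else 0
  /-- For some `k`, `(x₁ - x₂)^k Y_W(u, x₁) Y_W(v, x₂) ∈ Hom(W, W((x₁⁻¹, x₂⁻¹)))` and
  `x₀^k Y_W(Y(u, x₀) v, x₂) = ((x₁ - x₂)^k Y_W(u, x₁) Y_W(v, x₂))|_{x₁ = x₂ + x₀}`. -/
  assoc : ∀ u v : V, ∃ k : ℕ, ∀ w : W,
    BoundedAbove (fmul (binomPow 1 (-1) k) (prod12 (Y u).modes (Y v).modes w)) ∧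
    (fun a b => (Y ((A.Y u).coeff (a - k) v)).modes b w) =
      substTaylor (fmul (binomPow 1 (-1) k) (prod12 (Y u).modes (Y v).modes w))

/-- `W` is faithful: `v ↦ Y_W(v, x)` is injective. -/
def ModuleAtInfinity.Faithful {V : Type*} [AddCommGroup V] [Module ℂ V]
    {A : NonlocalVertexAlgebra V} {W : Type*} [AddCommGroup W] [Module ℂ W]
    (M : ModuleAtInfinity A W) : Prop := Function.Injective M.Y

/-- The relation
`(x₁ - x₂)^n Y(u, x₁) Y(v, x₂) - (-x₂ + x₁)^n ∑ᵢ ι_{x,0}(fᵢ)(x₂ - x₁) Y(v⁽ⁱ⁾, x₂) Y(u⁽ⁱ⁾, x₁)`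
`= ∑_{j = 0}^s Y(c⁽ʲ⁾, x₂) (1/j!) (∂/∂x₂)^j x₁⁻¹ δ(x₂/x₁)` on `V`. -/
def RelationOnAlgebra {V : Type*} [AddCommGroup V] [Module ℂ V] (A : NonlocalVertexAlgebra V)
    (n : ℤ) (u v : V) {r : ℕ} (us vs : Fin r → V) (f : Fin r → RatFunc ℂ)
    {s : ℕ} (c : Fin (s + 1) → V) : Prop :=
  ∀ w : V,
    fmul (binomPow 1 (-1) n) (prod12 (A.Y u).coeff (A.Y v).coeff w) -
      fmul (swapVars (binomPow (-1) 1 n))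
        (∑ i, fmul (swapVars (binomSubst (atZero (f i)) 1 (-1)))
          (prod21 (A.Y (vs i)).coeff (A.Y (us i)).coeff w)) =
    ∑ j : Fin (s + 1), fmul (deltaDeriv j) (constFst fun b => (A.Y (c j)).coeff b w)

/-- The relation
`(x₁ - x₂)^n ∑ᵢ ι_{x,∞}(fᵢ)(-x₁ + x₂) Y_W(v⁽ⁱ⁾, x₂) Y_W(u⁽ⁱ⁾, x₁) - (-x₂ + x₁)^n Y_W(u, x₁) Y_W(v, x₂)`
`= ∑_{j = 0}^s Y_W(c⁽ʲ⁾, x₂) (1/j!) (∂/∂x₂)^j x₁⁻¹ δ(x₂/x₁)` on `W`. -/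
def RelationOnModule {V : Type*} [AddCommGroup V] [Module ℂ V] {A : NonlocalVertexAlgebra V}
    {W : Type*} [AddCommGroup W] [Module ℂ W] (M : ModuleAtInfinity A W)
    (n : ℤ) (u v : V) {r : ℕ} (us vs : Fin r → V) (f : Fin r → RatFunc ℂ)
    {s : ℕ} (c : Fin (s + 1) → V) : Prop :=
  ∀ w : W,
    fmul (binomPow 1 (-1) n)
        (∑ i, fmul (binomSubst (atInfty (f i)) (-1) 1)
          (prod21 (M.Y (vs i)).modes (M.Y (us i)).modes w)) -
      fmul (swapVars (binomPow (-1) 1 n)) (prod12 (M.Y u).modes (M.Y v).modes w) =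
    ∑ j : Fin (s + 1), fmul (deltaDeriv j) (constFst fun b => (M.Y (c j)).modes b w)

end NLVA

end

/-! Both relations are equivalent to statements about the same vectors of `V`. For large `k`,
associativity says that `F = (x₁ - x₂)^k Y(u, x₁) Y(v, x₂) w` has Laurent polynomials as homogeneous
components and has the Taylor expansion `x₀^k Y(Y(u, x₀) v, x₂) w` at `x₁ = x₂ + x₀`. Such a series
is determined by its Taylor expansion (`eq_zero_of_substTaylor_eq_zero`).

The two expansions of `(x₁ - x₂)^(-J-1)` differ by a derivative of the delta function
(`diffPow_sub_diffPow'`), whose product with `F` sees only Taylor coefficients of `F`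
(`fmul_deltaDeriv`). So, once the two products agree after multiplication by `(x₁ - x₂)^k`, the
delta terms are read off from the coefficients of `Y(u, x) v`, and the relation fixes these as the
`c⁽ʲ⁾`.

A high power of `x₁ - x₂` kills the delta terms, so the relation forces the two products to agree up
to such a power. Choose a common denominator, `q fᵢ = pᵢ`, and compare Taylor expansions:
interchanging the variables turns associativity for `v⁽ⁱ⁾`, `u⁽ⁱ⁾` into a Taylor expansion of the
opposite product, with coefficients coming from `e^{xD} Y(v⁽ⁱ⁾, -x) u⁽ⁱ⁾`. Agreement then means
`Y(y, x₂) w = 0` for every coefficient `y` of `q(-x) Y(u, x) v - ∑ᵢ pᵢ(-x) e^{xD} Y(v⁽ⁱ⁾, -x) u⁽ⁱ⁾`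
(times `x^k`).

`relation_iff` combines both conditions into the form `Y(y, x₂) w = 0` for vectors `y` that do not
depend on the module. On `V`, taking `w = 1` gives `y = 0` by the creation property; on `W`,
faithfulness gives it. Conversely `y = 0` yields the relation on either space. Products of infinite
series are controlled throughout by supports well-ordered for a lexicographic order. -/

noncomputable section

namespace NLVA

/-! ### Multiplication by `x₁ - x₂` and the Cauchy product -/

section Shift

variable {E : Type*} [AddCommGroup E] [Module ℂ E]

/-- Multiplication by `x₁^i x₂^j`. -/
def shift (i j : ℤ) : (ℤ → ℤ → E) →ₗ[ℂ] (ℤ → ℤ → E) where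
  toFun S := fun a b => S (a - i) (b - j)
  map_add' _ _ := rfl
  map_smul' _ _ := rfl

@[simp]
theorem shift_apply (i j : ℤ) (S : ℤ → ℤ → E) (a b : ℤ) : shift i j S a b = S (a - i) (b - j) :=
  rfl

/-- Multiplication by `x₁ - x₂`. -/
def mulDiff : (ℤ → ℤ → E) →ₗ[ℂ] (ℤ → ℤ → E) := shift 1 0 - shift 0 1

theorem mulDiff_eq (S : ℤ → ℤ → E) : mulDiff S = shift 1 0 S - shift 0 1 S := rfl

@[simp]
theorem mulDiff_apply (S : ℤ → ℤ → E) (a b : ℤ) : mulDiff S a b = S (a - 1) b - S a (b - 1) := by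
  simp [mulDiff]

theorem shift_shift (i j k l : ℤ) (S : ℤ → ℤ → E) :
    shift i j (shift k l S) = shift (i + k) (j + l) S := by
  funext a b
  simp [sub_sub]

theorem mulDiff_pow_succ (k : ℕ) (S : ℤ → ℤ → E) :
    (mulDiff ^ (k + 1) : Module.End ℂ (ℤ → ℤ → E)) S =
      mulDiff ((mulDiff ^ k : Module.End ℂ (ℤ → ℤ → E)) S) := by
  rw [pow_succ', Module.End.mul_apply]

theorem mulDiff_pow_succ' (k : ℕ) (S : ℤ → ℤ → E) :
    (mulDiff ^ (k + 1) : Module.End ℂ (ℤ → ℤ → E)) S =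
      (mulDiff ^ k : Module.End ℂ (ℤ → ℤ → E)) (mulDiff S) := by
  rw [pow_succ, Module.End.mul_apply]

theorem fmul_shift_left (g : ℤ → ℤ → ℂ) (S : ℤ → ℤ → E) (i j : ℤ) :
    fmul (shift i j g) S = shift i j (fmul g S) := by
  funext a b
  simp only [fmul, shift_apply]
  rw [← finsum_comp_equiv (Equiv.addRight ((i, j) : ℤ × ℤ))]
  refine finsum_congr fun p => ?_
  simp [sub_sub, add_comm]

theorem fmul_shift_right (g : ℤ → ℤ → ℂ) (S : ℤ → ℤ → E) (i j : ℤ) :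
    fmul g (shift i j S) = shift i j (fmul g S) := by
  funext a b
  simp only [fmul, shift_apply]
  refine finsum_congr fun p => ?_
  rw [sub_right_comm, sub_right_comm b]

theorem fmul_smul_left (c : ℂ) (g : ℤ → ℤ → ℂ) (S : ℤ → ℤ → E) :
    fmul (c • g) S = c • fmul g S := by
  funext a b
  simp only [fmul, Pi.smul_apply, smul_eq_mul, mul_smul, smul_finsum]

theorem fmul_smul_right (c : ℂ) (g : ℤ → ℤ → ℂ) (S : ℤ → ℤ → E) :
    fmul g (c • S) = c • fmul g S := by
  funext a b
  simp only [fmul, Pi.smul_apply, smul_finsum, smul_comm c]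

@[simp]
theorem fmul_zero_right (g : ℤ → ℤ → ℂ) : fmul g (0 : ℤ → ℤ → E) = 0 := by
  funext a b
  simp [fmul]

/-- The products of the coefficients of `g` and `S` that contribute to any given coefficient of
`g S` are finite in number. -/
def MulSummable (g : ℤ → ℤ → ℂ) (S : ℤ → ℤ → E) : Prop :=
  ∀ a b, {p : ℤ × ℤ | g p.1 p.2 ≠ 0 ∧ S (a - p.1) (b - p.2) ≠ 0}.Finite

theorem MulSummable.finite_support {g : ℤ → ℤ → ℂ} {S : ℤ → ℤ → E} (h : MulSummable g S) (a b : ℤ) :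
    (Function.support fun p : ℤ × ℤ => g p.1 p.2 • S (a - p.1) (b - p.2)).Finite := by
  refine (h a b).subset fun p hp => ?_
  rw [Function.mem_support] at hp
  exact ⟨left_ne_zero_of_smul hp, right_ne_zero_of_smul hp⟩

theorem MulSummable.fmul_add_left {g h : ℤ → ℤ → ℂ} {S : ℤ → ℤ → E} (hg : MulSummable g S)
    (hh : MulSummable h S) : fmul (g + h) S = fmul g S + fmul h S := by
  funext a b
  simp only [fmul, Pi.add_apply, add_smul]
  exact finsum_add_distrib (hg.finite_support a b) (hh.finite_support a b)

theorem MulSummable.fmul_sub_left {g h : ℤ → ℤ → ℂ} {S : ℤ → ℤ → E} (hg : MulSummable g S)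
    (hh : MulSummable h S) : fmul (g - h) S = fmul g S - fmul h S := by
  funext a b
  simp only [fmul, Pi.sub_apply, sub_smul]
  exact finsum_sub_distrib (hg.finite_support a b) (hh.finite_support a b)

theorem MulSummable.fmul_add_right {g : ℤ → ℤ → ℂ} {S T : ℤ → ℤ → E} (hS : MulSummable g S)
    (hT : MulSummable g T) : fmul g (S + T) = fmul g S + fmul g T := by
  funext a b
  simp only [fmul, Pi.add_apply, smul_add]
  exact finsum_add_distrib (hS.finite_support a b) (hT.finite_support a b)

theorem MulSummable.fmul_sub_right {g : ℤ → ℤ → ℂ} {S T : ℤ → ℤ → E} (hS : MulSummable g S)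
    (hT : MulSummable g T) : fmul g (S - T) = fmul g S - fmul g T := by
  funext a b
  simp only [fmul, Pi.sub_apply, smul_sub]
  exact finsum_sub_distrib (hS.finite_support a b) (hT.finite_support a b)

omit [Module ℂ E] in
theorem MulSummable.shift_left {g : ℤ → ℤ → ℂ} {S : ℤ → ℤ → E} (h : MulSummable g S) (i j : ℤ) :
    MulSummable (shift i j g) S := by
  intro a b
  refine ((h (a - i) (b - j)).image fun p => (p.1 + i, p.2 + j)).subset ?_
  rintro ⟨p, q⟩ ⟨h1, h2⟩
  refine ⟨(p - i, q - j), ⟨h1, ?_⟩, by simp⟩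
  simpa using h2

theorem MulSummable.shift_right {g : ℤ → ℤ → ℂ} {S : ℤ → ℤ → E} (h : MulSummable g S) (i j : ℤ) :
    MulSummable g (shift i j S) := by
  intro a b
  refine (h (a - i) (b - j)).subset ?_
  rintro ⟨p, q⟩ ⟨h1, h2⟩
  refine ⟨h1, ?_⟩
  simpa [sub_right_comm] using h2

/-- Summability is essential: associativity of products of doubly infinite series fails in general,
and `finsum` takes the value zero on infinite supports. -/
theorem MulSummable.fmul_mulDiff_left {g : ℤ → ℤ → ℂ} {S : ℤ → ℤ → E} (h : MulSummable g S) :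
    fmul (mulDiff g) S = mulDiff (fmul g S) := by
  rw [mulDiff_eq, (h.shift_left 1 0).fmul_sub_left (h.shift_left 0 1), fmul_shift_left,
    fmul_shift_left, mulDiff_eq]

theorem MulSummable.fmul_mulDiff_right {g : ℤ → ℤ → ℂ} {S : ℤ → ℤ → E} (h : MulSummable g S) :
    fmul g (mulDiff S) = mulDiff (fmul g S) := by
  rw [mulDiff_eq, (h.shift_right 1 0).fmul_sub_right (h.shift_right 0 1), fmul_shift_right,
    fmul_shift_right, mulDiff_eq]

/-- The series `1` in two variables. -/
def oneSeries : ℤ → ℤ → ℂ := fun a b => if a = 0 ∧ b = 0 then 1 else 0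

@[simp]
theorem fmul_oneSeries (S : ℤ → ℤ → E) : fmul oneSeries S = S := by
  funext a b
  rw [fmul, finsum_eq_single _ ((0, 0) : ℤ × ℤ)]
  · simp [oneSeries]
  · rintro ⟨p, q⟩ h
    rw [Ne, Prod.mk.injEq] at h
    simp [oneSeries, h]

end Shift

/-! ### Series with lexicographically well-ordered support -/

section Support

variable {E : Type*} [AddCommGroup E] [Module ℂ E]

/-- The support of `S` is well-ordered for the lexicographic order of `ℤ × ℤ`, transported along the
automorphism `φ` of the group of exponents. -/
def LexSupport (φ : ℤ × ℤ ≃+ ℤ ×ₗ ℤ) (S : ℤ → ℤ → E) : Prop :=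
  (φ '' {p | S p.1 p.2 ≠ 0}).IsPWO

variable {φ : ℤ × ℤ ≃+ ℤ ×ₗ ℤ}

omit [Module ℂ E] in
theorem LexSupport.zero : LexSupport φ (0 : ℤ → ℤ → E) := by
  simp [LexSupport]

omit [Module ℂ E] in
theorem LexSupport.add {S T : ℤ → ℤ → E} (hS : LexSupport φ S) (hT : LexSupport φ T) :
    LexSupport φ (S + T) := by
  refine (hS.union hT).mono ?_
  rw [← Set.image_union]
  refine Set.image_mono fun p hp => ?_
  by_contra h
  simp only [Set.mem_union, Set.mem_ofPred_eq, not_or, not_not] at h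
  exact hp (by simp [h.1, h.2])

theorem LexSupport.smul {S : ℤ → ℤ → E} (hS : LexSupport φ S) (c : ℂ) : LexSupport φ (c • S) :=
  hS.mono (Set.image_mono fun _ hp => right_ne_zero_of_smul hp)

theorem LexSupport.sub {S T : ℤ → ℤ → E} (hS : LexSupport φ S) (hT : LexSupport φ T) :
    LexSupport φ (S - T) := by
  have := hS.add (hT.smul (-1))
  rwa [neg_one_smul, ← sub_eq_add_neg] at this

omit [Module ℂ E] in
theorem LexSupport.sum {ι : Type*} {s : Finset ι} {S : ι → ℤ → ℤ → E}
    (hS : ∀ i ∈ s, LexSupport φ (S i)) : LexSupport φ (∑ i ∈ s, S i) := by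
  classical
  induction s using Finset.induction_on with
  | empty => exact LexSupport.zero
  | insert i s hi ih =>
    rw [Finset.sum_insert hi]
    exact (hS i (by simp)).add (ih fun j hj => hS j (by simp [hj]))

theorem LexSupport.shift {S : ℤ → ℤ → E} (hS : LexSupport φ S) (i j : ℤ) :
    LexSupport φ (shift i j S) := by
  refine (Set.IsPWO.add (Set.isPWO_singleton (φ (i, j))) hS).mono ?_
  rintro _ ⟨p, hp, rfl⟩
  refine ⟨_, rfl, _, ⟨(p.1 - i, p.2 - j), hp, rfl⟩, ?_⟩
  simp only [← map_add]
  simp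

theorem LexSupport.mulDiff {S : ℤ → ℤ → E} (hS : LexSupport φ S) : LexSupport φ (mulDiff S) :=
  (hS.shift 1 0).sub (hS.shift 0 1)

theorem LexSupport.mulDiff_pow {S : ℤ → ℤ → E} (hS : LexSupport φ S) (k : ℕ) :
    LexSupport φ ((NLVA.mulDiff ^ k : Module.End ℂ (ℤ → ℤ → E)) S) := by
  induction k with
  | zero => exact hS
  | succ k ih => rw [mulDiff_pow_succ]; exact ih.mulDiff

omit [Module ℂ E] in
-- As for Hahn series: an element of an ordered group is a sum of members of two well-ordered sets
-- in finitely many ways.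
theorem LexSupport.summable {g : ℤ → ℤ → ℂ} {S : ℤ → ℤ → E} (hg : LexSupport φ g)
    (hS : LexSupport φ S) : MulSummable g S := by
  intro a b
  refine Set.Finite.of_finite_image (f := fun p : ℤ × ℤ => (φ p, φ ((a, b) - p)))
    ((Set.AddAntidiagonal.finite_of_isPWO hg hS (φ (a, b))).subset ?_) ?_
  · rintro _ ⟨p, ⟨h1, h2⟩, rfl⟩
    refine ⟨⟨p, h1, rfl⟩, ⟨_, h2, rfl⟩, ?_⟩
    simp
  · intro p _ q _ h
    exact φ.injective (Prod.ext_iff.1 h).1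

theorem LexSupport.fmul {g : ℤ → ℤ → ℂ} {S : ℤ → ℤ → E} (hg : LexSupport φ g)
    (hS : LexSupport φ S) : LexSupport φ (fmul g S) := by
  refine (Set.IsPWO.add hg hS).mono ?_
  rintro _ ⟨⟨a, b⟩, hp, rfl⟩
  obtain ⟨p, hp⟩ : ∃ p : ℤ × ℤ, g p.1 p.2 • S (a - p.1) (b - p.2) ≠ 0 := by
    by_contra! h
    exact hp (by simp [NLVA.fmul, h])
  refine ⟨_, ⟨p, left_ne_zero_of_smul hp, rfl⟩, _, ⟨(a, b) - p, right_ne_zero_of_smul hp, rfl⟩, ?_⟩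
  simp

theorem LexSupport.fmul_mulDiff_pow_left {g : ℤ → ℤ → ℂ} {S : ℤ → ℤ → E} (hg : LexSupport φ g)
    (hS : LexSupport φ S) (k : ℕ) :
    NLVA.fmul ((NLVA.mulDiff ^ k : Module.End ℂ (ℤ → ℤ → ℂ)) g) S =
      (NLVA.mulDiff ^ k : Module.End ℂ (ℤ → ℤ → E)) (NLVA.fmul g S) := by
  induction k with
  | zero => rfl
  | succ k ih =>
    rw [mulDiff_pow_succ, ((hg.mulDiff_pow k).summable hS).fmul_mulDiff_left, ih, mulDiff_pow_succ]

theorem LexSupport.fmul_mulDiff_pow_right {g : ℤ → ℤ → ℂ} {S : ℤ → ℤ → E} (hg : LexSupport φ g)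
    (hS : LexSupport φ S) (k : ℕ) :
    NLVA.fmul g ((NLVA.mulDiff ^ k : Module.End ℂ (ℤ → ℤ → E)) S) =
      (NLVA.mulDiff ^ k : Module.End ℂ (ℤ → ℤ → E)) (NLVA.fmul g S) := by
  induction k with
  | zero => rfl
  | succ k ih =>
    rw [mulDiff_pow_succ, (hg.summable (hS.mulDiff_pow k)).fmul_mulDiff_right, ih, mulDiff_pow_succ]

/-- Multiplication by `p(x₂ - x₁)`, for a polynomial `p`. -/
abbrev mulPoly (p : Polynomial ℂ) : Module.End ℂ (ℤ → ℤ → E) :=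
  Polynomial.aeval (-mulDiff : Module.End ℂ (ℤ → ℤ → E)) p

theorem mulPoly_add (p q : Polynomial ℂ) (S : ℤ → ℤ → E) :
    mulPoly (p + q) S = mulPoly p S + mulPoly q S := by
  rw [mulPoly, map_add, LinearMap.add_apply]

theorem mulPoly_smul (c : ℂ) (p : Polynomial ℂ) (S : ℤ → ℤ → E) :
    mulPoly (c • p) S = c • mulPoly p S := by
  rw [mulPoly, map_smul, LinearMap.smul_apply]

theorem mulPoly_X_mul (p : Polynomial ℂ) (S : ℤ → ℤ → E) :
    mulPoly (Polynomial.X * p) S = -NLVA.mulDiff (mulPoly p S) := by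
  rw [mulPoly, map_mul, Polynomial.aeval_X, Module.End.mul_apply, LinearMap.neg_apply]

theorem mulPoly_mulDiff_pow (p : Polynomial ℂ) (k : ℕ) (S : ℤ → ℤ → E) :
    mulPoly p ((NLVA.mulDiff ^ k : Module.End ℂ (ℤ → ℤ → E)) S) =
      (NLVA.mulDiff ^ k : Module.End ℂ (ℤ → ℤ → E)) (mulPoly p S) := by
  have h : Commute (mulPoly p) (NLVA.mulDiff ^ k : Module.End ℂ (ℤ → ℤ → E)) := by
    refine Commute.pow_right ?_ k
    -- Both operators are values of the same evaluation homomorphism on a commutative ring.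
    have : (NLVA.mulDiff : Module.End ℂ (ℤ → ℤ → E)) = mulPoly (-Polynomial.X) := by
      simp [mulPoly]
    rw [this, mulPoly, mulPoly, commute_iff_eq, ← map_mul, mul_comm, map_mul]
  exact DFunLike.congr_fun h.eq S

/-- An induction principle for statements about `p(x₂ - x₁) S`. -/
theorem mulPoly_induction {P : Polynomial ℂ → (ℤ → ℤ → E) → Prop} {S : ℤ → ℤ → E}
    (one : P 1 S) (add : ∀ p q S T, P p S → P q T → P (p + q) (S + T))
    (smul : ∀ (c : ℂ) p S, P p S → P (c • p) (c • S))
    (mul : ∀ p S, P p S → P (Polynomial.X * p) (-NLVA.mulDiff S)) (p : Polynomial ℂ) :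
    P p (mulPoly p S) := by
  induction p using Polynomial.induction_on' with
  | add p q hp hq => rw [mulPoly_add]; exact add _ _ _ _ hp hq
  | monomial m c =>
    rw [← mul_one c, ← smul_eq_mul, ← Polynomial.smul_monomial, mulPoly_smul]
    refine smul _ _ _ ?_
    induction m with
    | zero => simpa using one
    | succ m ih =>
      have : (Polynomial.monomial (m + 1) (1 : ℂ)) =
          Polynomial.X * Polynomial.monomial m (1 : ℂ) := by simp
      rw [this, mulPoly_X_mul]
      exact mul _ _ ih

end Support

/-! ### Binomial coefficients with integer entries -/

section Binomial

/-- The binomial coefficient with arbitrary integer entries, zero for a negative lower entry. -/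
def zchoose (n a : ℤ) : ℤ := if 0 ≤ a then Ring.choose n a.toNat else 0

theorem zchoose_natCast (n : ℤ) (a : ℕ) : zchoose n a = Ring.choose n a := by
  simp [zchoose]

theorem zchoose_of_neg {n a : ℤ} (h : a < 0) : zchoose n a = 0 := by
  simp [zchoose, h]

@[simp]
theorem zchoose_zero_right (n : ℤ) : zchoose n 0 = 1 := by
  simp [zchoose]

theorem zchoose_succ (n a : ℤ) : zchoose (n + 1) a = zchoose n a + zchoose n (a - 1) := by
  obtain h | rfl | h := lt_trichotomy a 0
  · simp [zchoose_of_neg h, zchoose_of_neg (show a - 1 < 0 by omega)]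
  · simp [zchoose_of_neg (show (-1 : ℤ) < 0 by omega)]
  · obtain ⟨k, rfl⟩ : ∃ k : ℕ, a = k + 1 := ⟨(a - 1).toNat, by omega⟩
    rw [add_sub_cancel_right, ← Nat.cast_succ, zchoose_natCast, zchoose_natCast, zchoose_natCast,
      Ring.choose_succ_succ, add_comm]

theorem zchoose_of_lt {n a : ℤ} (hn : 0 ≤ n) (h : n < a) : zchoose n a = 0 := by
  lift n to ℕ using hn
  lift a to ℕ using (by omega)
  rw [zchoose_natCast, Ring.choose_natCast, Nat.choose_eq_zero_of_lt (by omega), Nat.cast_zero]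

theorem zchoose_self {n : ℤ} (hn : 0 ≤ n) : zchoose n n = 1 := by
  lift n to ℕ using hn
  rw [zchoose_natCast, Ring.choose_natCast, Nat.choose_self, Nat.cast_one]

theorem zchoose_symm {n : ℤ} (hn : 0 ≤ n) (a : ℤ) : zchoose n (n - a) = zchoose n a := by
  obtain h | h := lt_or_ge a 0
  · rw [zchoose_of_neg h, zchoose_of_lt hn (by omega)]
  obtain h' | h' := lt_or_ge n a
  · rw [zchoose_of_lt hn h', zchoose_of_neg (by omega)]
  lift n to ℕ using hn
  lift a to ℕ using h
  rw [← Nat.cast_sub (by omega), zchoose_natCast, zchoose_natCast, Ring.choose_natCast,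
    Ring.choose_natCast, Nat.choose_symm (by omega)]

theorem choose_eq_neg_one_pow_mul (r : ℤ) (k : ℕ) :
    Ring.choose r k = (-1) ^ k * Ring.choose (k - 1 - r) k := by
  have := Ring.choose_neg (-r) k
  rw [neg_neg] at this
  rw [this, show -r + (k : ℤ) - 1 = k - 1 - r by ring, Units.smul_def, smul_eq_mul,
    Int.coe_negOnePow_natCast]

theorem choose_add_natCast_self (t : ℤ) (k : ℕ) :
    Ring.choose (t + k) k = (-1) ^ k * Ring.choose (-t - 1) k := by
  rw [choose_eq_neg_one_pow_mul, show (k : ℤ) - 1 - (t + k) = -t - 1 by ring]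

/-- Negating the upper entries makes all signs equal to `(-1)^k` and leaves the Chu–Vandermonde
convolution. This is the coefficient identity behind the interchange of variables in
`substTaylor_swapVars`. -/
theorem sum_antidiagonal_neg_one_pow_mul_choose (m b : ℤ) (k : ℕ) :
    ∑ p ∈ Finset.HasAntidiagonal.antidiagonal k, (-1) ^ p.1 * Ring.choose (b + p.2) p.2 * Ring.choose m p.1 =
      Ring.choose (b + k - m) k := by
  rw [show b + k - m = (b - m) + k by ring, choose_add_natCast_self,
    show -(b - m) - 1 = m + (-b - 1) by ring, Ring.add_choose_eq k (Commute.all _ _),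
    Finset.mul_sum]
  refine Finset.sum_congr rfl fun p hp => ?_
  rw [choose_add_natCast_self, ← Finset.HasAntidiagonal.mem_antidiagonal.1 hp, pow_add]
  ring

end Binomial

/-! ### The two expansions of `(x₁ - x₂)^n` and the delta function -/

section Binom

theorem binomPow_eq (α β : ℂ) (n a b : ℤ) :
    binomPow α β n a b = if a + b = n then zchoose n b * α ^ a * β ^ b else 0 := by
  simp only [binomPow, zchoose]
  split_ifs <;> simp_all

/-- Pascal's rule, valid for negative `n` as well. -/
theorem shift_binomPow {α β : ℂ} (hα : α ≠ 0) (hβ : β ≠ 0) (n : ℤ) :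
    binomPow α β (n + 1) = α • shift 1 0 (binomPow α β n) + β • shift 0 1 (binomPow α β n) := by
  funext a b
  simp only [Pi.add_apply, Pi.smul_apply, shift_apply, binomPow_eq, smul_eq_mul, sub_zero]
  by_cases h : a + b = n + 1
  · rw [if_pos h, if_pos (by omega), if_pos (by omega), zchoose_succ, zpow_sub_one₀ hα,
      zpow_sub_one₀ hβ]
    push_cast
    field_simp
  · rw [if_neg h, if_neg (by omega), if_neg (by omega)]
    simp

theorem binomPow_zero (α β : ℂ) : binomPow α β 0 = oneSeries := by
  funext a b
  rw [binomPow_eq, oneSeries]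
  by_cases hb : b = 0
  · by_cases ha : a = 0 <;> simp [ha, hb]
  · by_cases h : a + b = 0
    · obtain h' | h' := lt_or_gt_of_ne hb
      · simp [zchoose_of_neg h', hb]
      · simp [zchoose_of_lt le_rfl h', hb]
    · rw [if_neg h, if_neg (by tauto)]

/-- The expansion of `(x₁ - x₂)^n` in nonnegative powers of `x₂`. -/
abbrev diffPow (n : ℤ) : ℤ → ℤ → ℂ := binomPow 1 (-1) n

/-- The expansion of `(-x₂ + x₁)^n` in nonnegative powers of `x₁`. -/
abbrev diffPow' (n : ℤ) : ℤ → ℤ → ℂ := swapVars (binomPow (-1) 1 n)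

theorem mulDiff_diffPow (n : ℤ) : mulDiff (diffPow n) = diffPow (n + 1) := by
  rw [diffPow, diffPow, shift_binomPow one_ne_zero (by simp), mulDiff_eq]
  simp [sub_eq_add_neg]

theorem mulDiff_diffPow' (n : ℤ) : mulDiff (diffPow' n) = diffPow' (n + 1) := by
  rw [diffPow', diffPow', shift_binomPow (by simp) one_ne_zero, mulDiff_eq]
  funext a b
  simp [swapVars, sub_eq_add_neg, add_comm]

theorem mulDiff_pow_diffPow (n : ℤ) (k : ℕ) :
    (mulDiff ^ k : Module.End ℂ (ℤ → ℤ → ℂ)) (diffPow n) = diffPow (n + k) := by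
  induction k with
  | zero => simp
  | succ k ih => rw [mulDiff_pow_succ, ih, mulDiff_diffPow, add_assoc, Nat.cast_succ]

theorem mulDiff_pow_diffPow' (n : ℤ) (k : ℕ) :
    (mulDiff ^ k : Module.End ℂ (ℤ → ℤ → ℂ)) (diffPow' n) = diffPow' (n + k) := by
  induction k with
  | zero => simp
  | succ k ih => rw [mulDiff_pow_succ, ih, mulDiff_diffPow', add_assoc, Nat.cast_succ]

theorem diffPow_apply (n a b : ℤ) :
    diffPow n a b = if a + b = n then (zchoose n b : ℂ) * (-1) ^ b else 0 := by
  simp [diffPow, binomPow_eq]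

theorem diffPow'_apply (n a b : ℤ) :
    diffPow' n a b = if a + b = n then (zchoose n a : ℂ) * (-1) ^ b else 0 := by
  simp [diffPow', swapVars, binomPow_eq, add_comm]

theorem diffPow_eq_diffPow' {n : ℤ} (hn : 0 ≤ n) : diffPow n = diffPow' n := by
  funext a b
  rw [diffPow_apply, diffPow'_apply]
  split_ifs with h
  · rw [← zchoose_symm hn b, ← h, add_sub_cancel_right]
  · rfl

theorem derivSnd_iterate_delta (j : ℕ) (a b : ℤ) :
    (derivSnd^[j] delta) a b =
      if a + b = -j - 1 then ((j.factorial : ℂ) * (Ring.choose (b + j) j : ℤ)) else 0 := by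
  induction j generalizing b with
  | zero =>
    simp only [Function.iterate_zero, id, delta]
    simp
    congr 1
    simp only [eq_iff_iff]
    omega
  | succ j ih =>
    rw [Function.iterate_succ_apply', derivSnd, ih]
    by_cases h : a + b = -((j + 1 : ℕ) : ℤ) - 1
    · rw [if_pos h, if_pos (by push_cast at h; omega)]
      -- With `r = b + 1 + j`, this reads `(j + 1) (r choose j + 1) = (r choose j) (b + 1)`: the
      -- factor `b + 1` produced by the derivative is absorbed.
      have := Ring.choose_smul_choose (b + 1 + j) (Nat.le_succ j)
      rw [Nat.choose_succ_self_right, Nat.succ_eq_add_one, Nat.add_sub_cancel_left,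
        Ring.choose_one_right, nsmul_eq_mul, add_sub_cancel_right] at this
      have h2 := congrArg (Int.cast : ℤ → ℂ) this
      push_cast at h2
      rw [show b + ((j + 1 : ℕ) : ℤ) = b + 1 + j by push_cast; ring, Nat.factorial_succ]
      push_cast
      linear_combination -(j.factorial : ℂ) * h2
    · rw [if_neg h, if_neg (by push_cast at h; omega), mul_zero]

theorem deltaDeriv_apply (j : ℕ) (a b : ℤ) :
    deltaDeriv j a b = if a + b = -j - 1 then ((Ring.choose (-1 - a) j : ℤ) : ℂ) else 0 := by
  rw [deltaDeriv, derivSnd_iterate_delta]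
  split_ifs with h
  · rw [← mul_assoc, inv_mul_cancel₀ (by exact_mod_cast j.factorial_ne_zero), one_mul,
      show b + j = -1 - a by omega]
  · simp

/-- In total degree `-j - 1` the exponents are not both nonnegative, so at most one expansion
contributes to each coefficient. If both are negative, neither does, and `0 ≤ -1 - a < j` makes the
delta coefficient vanish too. -/
theorem diffPow_sub_diffPow' (j : ℕ) : diffPow (-j - 1) - diffPow' (-j - 1) = deltaDeriv j := by
  funext a b
  rw [Pi.sub_apply, Pi.sub_apply, diffPow_apply, diffPow'_apply, deltaDeriv_apply]
  split_ifs with h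
  swap
  · simp
  have key (t : ℕ) : zchoose (-j - 1) t = (-1) ^ t * Ring.choose ((j + t : ℕ) : ℤ) j := by
    rw [zchoose_natCast, choose_eq_neg_one_pow_mul]
    congr 1
    rw [show (t : ℤ) - 1 - (-j - 1) = ((j + t : ℕ) : ℤ) by push_cast; ring, Ring.choose_natCast,
      Ring.choose_natCast, Nat.choose_symm_add]
  by_cases hb : 0 ≤ b
  · lift b to ℕ using hb
    rw [key, zchoose_of_neg (show a < 0 by omega), show -1 - a = ((j + b : ℕ) : ℤ) by
      push_cast; omega]
    push_cast
    rw [zpow_natCast, mul_right_comm, ← mul_pow]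
    simp
  by_cases ha : 0 ≤ a
  · lift a to ℕ using ha
    rw [key, zchoose_of_neg (show b < 0 by omega), show b = -(j + a + 1 : ℕ) by push_cast; omega,
      choose_eq_neg_one_pow_mul (-1 - a) j, zpow_neg, zpow_natCast, ← inv_pow, inv_neg, inv_one,
      show (j : ℤ) - 1 - (-1 - a) = ((j + a : ℕ) : ℤ) by push_cast; ring]
    push_cast
    have h1 : ((-1 : ℂ) ^ a) * (-1) ^ a = 1 := by rw [← mul_pow]; simp
    rw [pow_add, pow_add]
    linear_combination ((-1) ^ j * ((Ring.choose ((j : ℤ) + a) j : ℤ) : ℂ)) * h1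
  · rw [zchoose_of_neg (show b < 0 by omega), zchoose_of_neg (show a < 0 by omega),
      ← zchoose_natCast, zchoose_of_lt (by omega) (by omega)]
    simp

end Binom

/-! ### Derivatives of the delta function with vector coefficients -/

section DeltaCoefficients

variable {E : Type*} [AddCommGroup E] [Module ℂ E]

theorem fmul_deltaDeriv_constFst (j : ℕ) (g : ℤ → E) (a b : ℤ) :
    fmul (deltaDeriv j) (constFst g) a b = (Ring.choose (-1 - a) j : ℤ) • g (a + b + 1 + j) := by
  rw [fmul, finsum_eq_single _ ((a, -j - 1 - a) : ℤ × ℤ)]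
  · simp only [deltaDeriv_apply, constFst, sub_self, if_true]
    rw [if_pos (by ring), Int.cast_smul_eq_zsmul]
    congr 2
    ring
  · rintro ⟨p, q⟩ h
    simp only [deltaDeriv_apply, constFst]
    by_cases h1 : a - p = 0
    · rw [if_neg, zero_smul]
      rintro h2
      exact h (Prod.ext (by dsimp; omega) (by dsimp; omega))
    · rw [if_neg h1, smul_zero]

theorem mulDiff_fmul_deltaDeriv_zero (g : ℤ → E) :
    mulDiff (fmul (deltaDeriv 0) (constFst g)) = 0 := by
  funext a b
  simp only [mulDiff_apply, fmul_deltaDeriv_constFst, Ring.choose_zero_right, Pi.zero_apply]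
  rw [sub_eq_zero]
  congr 2
  ring

theorem mulDiff_fmul_deltaDeriv_succ (j : ℕ) (g : ℤ → E) :
    mulDiff (fmul (deltaDeriv (j + 1)) (constFst g)) = fmul (deltaDeriv j) (constFst g) := by
  funext a b
  simp only [mulDiff_apply, fmul_deltaDeriv_constFst]
  rw [show -1 - (a - 1) = -1 - a + 1 by ring, Ring.choose_succ_succ,
    show a - 1 + b + 1 + ((j + 1 : ℕ) : ℤ) = a + b + 1 + j by push_cast; ring,
    show a + (b - 1) + 1 + ((j + 1 : ℕ) : ℤ) = a + b + 1 + j by push_cast; ring, add_smul,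
    add_sub_cancel_right]

theorem mulDiff_pow_fmul_deltaDeriv {j k : ℕ} (h : j < k) (g : ℤ → E) :
    (mulDiff ^ k : Module.End ℂ (ℤ → ℤ → E)) (fmul (deltaDeriv j) (constFst g)) = 0 := by
  induction k generalizing j with
  | zero => omega
  | succ k ih =>
    rw [mulDiff_pow_succ']
    cases j with
    | zero => rw [mulDiff_fmul_deltaDeriv_zero, map_zero]
    | succ j => rw [mulDiff_fmul_deltaDeriv_succ, ih (by omega)]

/-- At `x₁^(-1-j)` the `i`-th term carries the factor `j choose i`, so the system is unitriangular.
-/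
theorem eq_zero_of_sum_fmul_deltaDeriv_eq_zero {K : ℕ} {g : ℕ → ℤ → E}
    (h : ∑ j ∈ Finset.range K, fmul (deltaDeriv j) (constFst (g j)) = 0) {j : ℕ} (hj : j < K) :
    g j = 0 := by
  induction j using Nat.strong_induction_on with
  | _ j ih =>
  funext c
  have h1 := congrFun (congrFun h (-1 - j)) c
  simp only [Finset.sum_apply, fmul_deltaDeriv_constFst, sub_sub_cancel, Ring.choose_natCast,
    Pi.zero_apply] at h1
  rw [Finset.sum_eq_single_of_mem j (Finset.mem_range.2 hj)] at h1
  · rw [show -1 - (j : ℤ) + c + 1 + j = c by ring] at h1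
    simpa using h1
  · intro i _ hi
    obtain h2 | h2 := lt_or_gt_of_ne hi
    · simp [ih i h2 (h2.trans hj)]
    · simp [Nat.choose_eq_zero_of_lt h2]

end DeltaCoefficients

/-! ### The substitution `x₁ = x₂ + x₀` -/

section Taylor

variable {E : Type*} [AddCommGroup E]

/-- Every homogeneous component of `S` is a Laurent polynomial. -/
def DiagFinite (S : ℤ → ℤ → E) : Prop := ∀ d, {n | S n (d - n) ≠ 0}.Finite

theorem BoundedAbove.diagFinite {S : ℤ → ℤ → E} (h : BoundedAbove S) : DiagFinite S := by
  obtain ⟨N, hN⟩ := h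
  refine fun d => (Set.finite_Icc (d - N) N).subset fun n hn => ?_
  by_contra h
  refine hn (hN _ _ ?_)
  rw [Set.mem_Icc] at h
  omega

/-- The exponents of both variables in `S` are jointly bounded below. -/
def BoundedBelow (S : ℤ → ℤ → E) : Prop := ∃ N : ℤ, ∀ a b : ℤ, (a < N ∨ b < N) → S a b = 0

theorem BoundedBelow.diagFinite {S : ℤ → ℤ → E} (h : BoundedBelow S) : DiagFinite S := by
  obtain ⟨N, hN⟩ := h
  refine fun d => (Set.finite_Icc N (d - N)).subset fun n hn => ?_
  by_contra h
  refine hn (hN _ _ ?_)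
  rw [Set.mem_Icc] at h
  omega

theorem DiagFinite.add {S T : ℤ → ℤ → E} (hS : DiagFinite S) (hT : DiagFinite T) :
    DiagFinite (S + T) := by
  refine fun d => ((hS d).union (hT d)).subset fun n hn => ?_
  by_contra h
  simp only [Set.mem_union, Set.mem_ofPred_eq, not_or, not_not] at h
  exact hn (by simp [h.1, h.2])

theorem DiagFinite.zero : DiagFinite (0 : ℤ → ℤ → E) := fun d => by simp

theorem DiagFinite.swapVars {S : ℤ → ℤ → E} (hS : DiagFinite S) : DiagFinite (swapVars S) := by
  refine fun d => ((hS d).image fun n => d - n).subset fun n hn => ⟨d - n, ?_, by simp⟩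
  simpa [NLVA.swapVars] using hn

theorem substTaylor_eq_sum {S : ℤ → ℤ → E} {a b : ℤ} {t : Finset ℤ}
    (ht : ∀ n ∉ t, S n (b + a - n) = 0) :
    substTaylor S a b = ∑ n ∈ t, zchoose n a • S n (b + a - n) := by
  rw [substTaylor]
  simp only [zchoose]
  split_ifs with h
  · refine finsum_eq_sum_of_support_subset _ fun n hn => ?_
    by_contra h'
    exact hn (by dsimp only; rw [ht n h', smul_zero])
  · simp

theorem substTaylor_eq_finsum (S : ℤ → ℤ → E) (a b : ℤ) :
    substTaylor S a b = ∑ᶠ n, zchoose n a • S n (b + a - n) := by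
  rw [substTaylor]
  simp only [zchoose]
  split_ifs with h
  · rfl
  · simp

theorem substTaylor_of_neg (S : ℤ → ℤ → E) {a : ℤ} (ha : a < 0) (b : ℤ) :
    substTaylor S a b = 0 := by
  rw [substTaylor, if_neg (by omega)]

theorem DiagFinite.finite_support {S : ℤ → ℤ → E} (hS : DiagFinite S) (a b : ℤ) :
    (Function.support fun n => zchoose n a • S n (b + a - n)).Finite :=
  (hS (b + a)).subset fun _ hn => right_ne_zero_of_smul hn

theorem substTaylor_add {S T : ℤ → ℤ → E} (hS : DiagFinite S) (hT : DiagFinite T) :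
    substTaylor (S + T) = substTaylor S + substTaylor T := by
  funext a b
  simp only [substTaylor_eq_finsum, Pi.add_apply, smul_add]
  exact finsum_add_distrib (hS.finite_support a b) (hT.finite_support a b)

variable [Module ℂ E]

theorem DiagFinite.smul {S : ℤ → ℤ → E} (hS : DiagFinite S) (c : ℂ) : DiagFinite (c • S) :=
  fun d => (hS d).subset fun _ hn => right_ne_zero_of_smul hn

theorem DiagFinite.neg {S : ℤ → ℤ → E} (hS : DiagFinite S) : DiagFinite (-S) := by
  simpa using hS.smul (-1)

theorem DiagFinite.sub {S T : ℤ → ℤ → E} (hS : DiagFinite S) (hT : DiagFinite T) :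
    DiagFinite (S - T) := by
  simpa [sub_eq_add_neg] using hS.add hT.neg

theorem DiagFinite.shift {S : ℤ → ℤ → E} (hS : DiagFinite S) (i j : ℤ) :
    DiagFinite (shift i j S) := by
  refine fun d => ((hS (d - i - j)).image fun n => n + i).subset fun n hn => ⟨n - i, ?_, by simp⟩
  rw [Set.mem_ofPred_eq] at hn ⊢
  rw [show d - i - j - (n - i) = d - n - j by ring]
  exact hn

theorem DiagFinite.mulDiff {S : ℤ → ℤ → E} (hS : DiagFinite S) : DiagFinite (mulDiff S) :=
  (hS.shift 1 0).sub (hS.shift 0 1)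

theorem DiagFinite.mulDiff_pow {S : ℤ → ℤ → E} (hS : DiagFinite S) (k : ℕ) :
    DiagFinite ((NLVA.mulDiff ^ k : Module.End ℂ (ℤ → ℤ → E)) S) := by
  induction k with
  | zero => exact hS
  | succ k ih => rw [mulDiff_pow_succ]; exact ih.mulDiff

theorem substTaylor_smul (c : ℂ) (S : ℤ → ℤ → E) : substTaylor (c • S) = c • substTaylor S := by
  funext a b
  simp only [substTaylor_eq_finsum, Pi.smul_apply, smul_finsum, smul_comm c]

theorem substTaylor_neg (S : ℤ → ℤ → E) : substTaylor (-S) = -substTaylor S := by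
  simpa using substTaylor_smul (-1) S

theorem substTaylor_sub {S T : ℤ → ℤ → E} (hS : DiagFinite S) (hT : DiagFinite T) :
    substTaylor (S - T) = substTaylor S - substTaylor T := by
  rw [sub_eq_add_neg, substTaylor_add hS hT.neg, substTaylor_neg, ← sub_eq_add_neg]

theorem substTaylor_shift_snd (S : ℤ → ℤ → E) (a b : ℤ) :
    substTaylor (shift 0 1 S) a b = substTaylor S a (b - 1) := by
  simp only [substTaylor_eq_finsum, shift_apply, sub_zero]
  refine finsum_congr fun n => ?_
  congr 2
  ring

theorem substTaylor_shift_fst {S : ℤ → ℤ → E} (hS : DiagFinite S) (a b : ℤ) :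
    substTaylor (shift 1 0 S) a b = substTaylor S a (b - 1) + substTaylor S (a - 1) b := by
  have h1 := hS.finite_support a (b - 1)
  have h2 := hS.finite_support (a - 1) b
  simp only [substTaylor_eq_finsum, shift_apply, sub_zero]
  rw [← finsum_add_distrib h1 h2, ← finsum_comp_equiv (Equiv.addRight (1 : ℤ))]
  refine finsum_congr fun n => ?_
  rw [Equiv.coe_addRight, zchoose_succ, add_smul, add_sub_cancel_right]
  congr 3 <;> ring

/-- The factor `x₁ - x₂` becomes `x₀`. -/
theorem substTaylor_mulDiff {S : ℤ → ℤ → E} (hS : DiagFinite S) (a b : ℤ) :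
    substTaylor (mulDiff S) a b = substTaylor S (a - 1) b := by
  rw [mulDiff_eq, substTaylor_sub (hS.shift 1 0) (hS.shift 0 1), Pi.sub_apply, Pi.sub_apply,
    substTaylor_shift_fst hS, substTaylor_shift_snd, add_sub_cancel_left]

theorem substTaylor_mulDiff_pow {S : ℤ → ℤ → E} (hS : DiagFinite S) (k : ℕ) (a b : ℤ) :
    substTaylor ((mulDiff ^ k : Module.End ℂ (ℤ → ℤ → E)) S) a b = substTaylor S (a - k) b := by
  induction k generalizing a with
  | zero => simp
  | succ k ih =>
    rw [mulDiff_pow_succ, substTaylor_mulDiff (hS.mulDiff_pow k), ih]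
    congr 1
    push_cast
    ring

/-- Within one total degree, suppose all exponents of `x₁` are nonnegative and `M` is the largest.
Then only the top term contributes to `x₀^M`, with factor one. A power of `x₁`, which the
substitution turns into a power of `x₂ + x₀`, reduces to this case. -/
theorem eq_zero_of_substTaylor_eq_zero {S : ℤ → ℤ → E} (hS : DiagFinite S)
    (h : substTaylor S = 0) : S = 0 := by
  -- `-N` bounds the exponents of `x₁` from below in degree `d`; the induction multiplies by `x₁`,
  -- so `S` and `d` must vary.
  have main (N : ℕ) : ∀ S : ℤ → ℤ → E, DiagFinite S → substTaylor S = 0 → ∀ d,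
      (∀ n < (-N : ℤ), S n (d - n) = 0) → ∀ n, S n (d - n) = 0 := by
    induction N with
    | zero =>
      intro S hS h d hd
      by_contra! hne
      have hne' : (hS d).toFinset.Nonempty := by
        obtain ⟨n, hn⟩ := hne
        exact ⟨n, by simpa using hn⟩
      set M := (hS d).toFinset.max' hne' with hM
      have hMmem : S M (d - M) ≠ 0 := by simpa using (hS d).toFinset.max'_mem hne'
      have hM0 : 0 ≤ M := by
        by_contra h0
        exact hMmem (hd M (by simpa using h0))
      have h1 := congrFun (congrFun h M) (d - M)
      rw [substTaylor_eq_sum (t := (hS d).toFinset) (fun n hn => by simpa using hn),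
        Finset.sum_eq_single_of_mem M ((hS d).toFinset.max'_mem hne'), zchoose_self hM0] at h1
      · refine hMmem ?_
        simpa using h1
      · intro n hn hnM
        have hn' : n < M := lt_of_le_of_ne ((hS d).toFinset.le_max' n hn) hnM
        obtain h0 | h0 := lt_or_ge n 0
        · rw [show d - M + M - n = d - n by ring, hd n (by simpa using h0), smul_zero]
        · rw [zchoose_of_lt h0 hn', zero_smul]
    | succ N ih =>
      intro S hS h d hd n
      have h2 := ih (shift 1 0 S) (hS.shift 1 0) (by
        funext a b
        simp [substTaylor_shift_fst hS, h]) (d + 1) (fun n hn => by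
          rw [shift_apply, show d + 1 - n - 0 = d - (n - 1) by ring]
          exact hd _ (by push_cast; omega)) (n + 1)
      rw [shift_apply, show d + 1 - (n + 1) - 0 = d - n by ring] at h2
      simpa using h2
  funext a b
  have hbd := (hS (a + b)).bddBelow
  obtain ⟨B, hB⟩ := hbd
  have := main (-B).toNat S hS h (a + b) (fun n hn => by
    by_contra h0
    have : B ≤ n := hB h0
    omega) a
  simpa using this

/-- Finiteness in each degree is what excludes the delta function, which `x₁ - x₂` annihilates. -/
theorem eq_zero_of_mulDiff_pow_eq_zero {S : ℤ → ℤ → E} (hS : DiagFinite S) {k : ℕ}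
    (h : (mulDiff ^ k : Module.End ℂ (ℤ → ℤ → E)) S = 0) : S = 0 := by
  refine eq_zero_of_substTaylor_eq_zero hS ?_
  funext a b
  have := substTaylor_mulDiff_pow hS k (a + k) b
  rw [h, add_sub_cancel_right] at this
  rw [← this]
  simp [substTaylor]

omit [Module ℂ E] in
/-- Interchange of the two variables, on Taylor coefficients. -/
theorem substTaylor_swapVars {S : ℤ → ℤ → E} (hS : DiagFinite S) (a : ℕ) (b : ℤ) :
    substTaylor (swapVars S) a b = ∑ p ∈ Finset.HasAntidiagonal.antidiagonal a,
      ((-1) ^ p.1 * Ring.choose (b + p.2) p.2 : ℤ) • substTaylor S p.1 (b + p.2) := by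
  set t := (hS (b + a)).toFinset with ht
  have ht' (m : ℤ) (hm : m ∉ t) : S m (b + a - m) = 0 := by simpa [ht] using hm
  rw [substTaylor_eq_sum (t := t.map (Equiv.subLeft (b + (a : ℤ))).toEmbedding), Finset.sum_map]
  swap
  · intro n hn
    rw [swapVars]
    by_contra h
    refine hn (Finset.mem_map.2 ⟨b + a - n, by simpa [ht] using h, by simp⟩)
  have h1 (p) (hp : p ∈ Finset.HasAntidiagonal.antidiagonal a) :
      ((-1) ^ p.1 * Ring.choose (b + p.2) p.2 : ℤ) • substTaylor S p.1 (b + p.2) =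
        ∑ m ∈ t, ((-1) ^ p.1 * Ring.choose (b + p.2) p.2 * Ring.choose m p.1 : ℤ) •
          S m (b + a - m) := by
    have h2 : b + (p.2 : ℤ) + p.1 = b + a := by
      rw [← Finset.HasAntidiagonal.mem_antidiagonal.1 hp]; push_cast; ring
    rw [substTaylor_eq_sum (t := t) (by rw [h2]; exact ht'), h2, Finset.smul_sum]
    simp only [mul_smul, zchoose_natCast]
  rw [Finset.sum_congr rfl h1, Finset.sum_comm]
  refine Finset.sum_congr rfl fun m _ => ?_
  rw [← Finset.sum_smul, sum_antidiagonal_neg_one_pow_mul_choose]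
  simp [swapVars, zchoose_natCast]

/-- The product of a series with a derivative of the delta function depends only on the Taylor
coefficients of the series. -/
theorem fmul_deltaDeriv {S : ℤ → ℤ → E} (hS : DiagFinite S) (J : ℕ) :
    fmul (deltaDeriv J) S = ∑ p ∈ Finset.HasAntidiagonal.antidiagonal J,
      fmul (deltaDeriv p.2) (constFst (substTaylor S p.1)) := by
  funext a b
  simp only [Finset.sum_apply, fmul_deltaDeriv_constFst]
  set t := (hS (a + b + 1 + J)).toFinset with ht
  have ht' (m : ℤ) (hm : m ∉ t) : S m (a + b + 1 + J - m) = 0 := by simpa [ht] using hm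
  have h1 (p) (hp : p ∈ Finset.HasAntidiagonal.antidiagonal J) :
      (Ring.choose (-1 - a) p.2 : ℤ) • substTaylor S p.1 (a + b + 1 + p.2) =
        ∑ m ∈ t, (Ring.choose (-1 - a) p.2 * Ring.choose m p.1 : ℤ) •
          S m (a + b + 1 + J - m) := by
    have h2 : a + b + 1 + (p.2 : ℤ) + p.1 = a + b + 1 + J := by
      rw [← Finset.HasAntidiagonal.mem_antidiagonal.1 hp]; push_cast; ring
    rw [substTaylor_eq_sum (t := t) (by rw [h2]; exact ht'), h2, Finset.smul_sum]
    simp only [mul_smul, zchoose_natCast]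
  rw [Finset.sum_congr rfl h1, Finset.sum_comm]
  -- The coefficients of the delta derivative live on `p + q = -J - 1`; this line is parametrized by
  -- the exponent `n = a - p` of `x₁` left for `S`. The Vandermonde identity for `m + (-1 - a)` then
  -- matches the two sides.
  obtain ⟨e, he⟩ : ∃ e : ℤ ↪ ℤ × ℤ, ∀ n, e n = (a - n, -J - 1 - a + n) :=
    ⟨⟨fun n => (a - n, -J - 1 - a + n), fun m n h => by simpa using (Prod.ext_iff.1 h).1⟩,
      fun _ => rfl⟩
  rw [fmul, finsum_eq_sum_of_support_subset (s := t.map e), Finset.sum_map]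
  · refine Finset.sum_congr rfl fun m _ => ?_
    rw [← Finset.sum_smul]
    simp only [he, deltaDeriv_apply]
    rw [if_pos (by ring), Int.cast_smul_eq_zsmul, show -1 - (a - m) = m + (-1 - a) by ring,
      Ring.add_choose_eq _ (Commute.all _ _), sub_sub_cancel]
    congr 1
    · exact Finset.sum_congr rfl fun p _ => mul_comm _ _
    · congr 1; ring
  · rintro ⟨p, q⟩ hp
    have h2 : p + q = -J - 1 := by
      by_contra h
      exact hp (by simp [deltaDeriv_apply, h])
    have h3 : S (a - p) (b - q) ≠ 0 := right_ne_zero_of_smul hp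
    simp only [Finset.coe_map, Set.mem_image, Finset.mem_coe, he]
    refine ⟨a - p, ?_, Prod.ext (by simp) (by dsimp; omega)⟩
    by_contra h
    refine h3 ?_
    rw [← ht' _ h]
    congr 1
    omega

end Taylor

/-! ### Expansions of rational functions of `x₂ - x₁` -/

section Expansion

/-- `h f` is an expansion of `f(x₂ - x₁)` for `f ∈ ℂ(x)`, with support well-ordered along `φ`. -/
structure IsExpansion (φ : ℤ × ℤ ≃+ ℤ ×ₗ ℤ) (h : RatFunc ℂ →ₗ[ℂ] ℤ → ℤ → ℂ) : Prop where
  lexSupport : ∀ f, LexSupport φ (h f)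
  map_one : h 1 = oneSeries
  map_X_mul : ∀ f, h (RatFunc.X * f) = -mulDiff (h f)

variable {φ : ℤ × ℤ ≃+ ℤ ×ₗ ℤ} {h : RatFunc ℂ →ₗ[ℂ] ℤ → ℤ → ℂ}

theorem IsExpansion.mulPoly_apply (hh : IsExpansion φ h) (p : Polynomial ℂ) (f : RatFunc ℂ) :
    mulPoly p (h f) = h (algebraMap _ _ p * f) := by
  refine mulPoly_induction (P := fun p S => S = h (algebraMap _ _ p * f)) (by simp) ?_ ?_ ?_ p
  · rintro p q _ _ rfl rfl
    rw [map_add, add_mul, map_add]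
  · rintro c p _ rfl
    rw [← map_smul, ← smul_mul_assoc, ← algebraMap_smul (RatFunc ℂ) c (_ : RatFunc ℂ),
      Polynomial.smul_eq_C_mul, (algebraMap (Polynomial ℂ) (RatFunc ℂ)).map_mul,
      RatFunc.algebraMap_C, smul_eq_mul]
    rfl
  · rintro p _ rfl
    rw [(algebraMap (Polynomial ℂ) (RatFunc ℂ)).map_mul, RatFunc.algebraMap_X, mul_assoc,
      hh.map_X_mul]

variable {E : Type*} [AddCommGroup E] [Module ℂ E]

theorem LexSupport.fmul_mulPoly_left {g : ℤ → ℤ → ℂ} {S : ℤ → ℤ → E} (hg : LexSupport φ g)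
    (hS : LexSupport φ S) (p : Polynomial ℂ) :
    NLVA.fmul (NLVA.mulPoly p g) S = NLVA.mulPoly p (NLVA.fmul g S) := by
  -- The support condition is carried along because additivity of the product needs summability.
  refine (mulPoly_induction (P := fun p g' => LexSupport φ g' ∧
    NLVA.fmul g' S = NLVA.mulPoly p (NLVA.fmul g S)) ⟨hg, by simp⟩ ?_ ?_ ?_ p).2
  · rintro p q g₁ g₂ ⟨h1, h1'⟩ ⟨h2, h2'⟩
    refine ⟨h1.add h2, ?_⟩
    rw [(h1.summable hS).fmul_add_left (h2.summable hS), h1', h2', mulPoly_add]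
  · rintro c p g₁ ⟨h1, h1'⟩
    refine ⟨h1.smul c, ?_⟩
    rw [fmul_smul_left, h1', mulPoly_smul]
  · rintro p g₁ ⟨h1, h1'⟩
    rw [← neg_one_smul ℂ]
    refine ⟨h1.mulDiff.smul (-1), ?_⟩
    rw [fmul_smul_left, (h1.summable hS).fmul_mulDiff_left, h1', neg_one_smul, mulPoly_X_mul]

theorem LexSupport.fmul_mulPoly_right {g : ℤ → ℤ → ℂ} {S : ℤ → ℤ → E} (hg : LexSupport φ g)
    (hS : LexSupport φ S) (p : Polynomial ℂ) :
    NLVA.fmul g (NLVA.mulPoly p S) = NLVA.mulPoly p (NLVA.fmul g S) := by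
  refine (mulPoly_induction (P := fun p S' => LexSupport φ S' ∧
    NLVA.fmul g S' = NLVA.mulPoly p (NLVA.fmul g S)) ⟨hS, by simp⟩ ?_ ?_ ?_ p).2
  · rintro p q g₁ g₂ ⟨h1, h1'⟩ ⟨h2, h2'⟩
    refine ⟨h1.add h2, ?_⟩
    rw [(hg.summable h1).fmul_add_right (hg.summable h2), h1', h2', mulPoly_add]
  · rintro c p g₁ ⟨h1, h1'⟩
    refine ⟨h1.smul c, ?_⟩
    rw [fmul_smul_right, h1', mulPoly_smul]
  · rintro p g₁ ⟨h1, h1'⟩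
    rw [← neg_one_smul ℂ]
    refine ⟨h1.mulDiff.smul (-1), ?_⟩
    rw [fmul_smul_right, (hg.summable h1).fmul_mulDiff_right, h1', neg_one_smul, mulPoly_X_mul]

/-- Multiplication by `q(x₂ - x₁)`, for `q ≠ 0`, is injective on series with well-ordered
support. -/
theorem IsExpansion.eq_zero_of_mulPoly_eq_zero (hh : IsExpansion φ h) {q : Polynomial ℂ}
    (hq : q ≠ 0) {S : ℤ → ℤ → E} (hS : LexSupport φ S) (h0 : mulPoly q S = 0) : S = 0 := by
  have hq' : algebraMap (Polynomial ℂ) (RatFunc ℂ) q ≠ 0 := by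
    simpa using RatFunc.algebraMap_ne_zero hq
  have h1 := hh.mulPoly_apply q (algebraMap _ _ q)⁻¹
  rw [mul_inv_cancel₀ hq', hh.map_one] at h1
  rw [← fmul_oneSeries S, ← h1, (hh.lexSupport _).fmul_mulPoly_left hS,
    ← (hh.lexSupport _).fmul_mulPoly_right hS, h0, fmul_zero_right]

theorem IsExpansion.mulPoly_fmul (hh : IsExpansion φ h) {p q : Polynomial ℂ} {f : RatFunc ℂ}
    (hpq : algebraMap _ _ q * f = algebraMap _ _ p) {S : ℤ → ℤ → E} (hS : LexSupport φ S) :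
    mulPoly q (fmul (h f) S) = mulPoly p S := by
  have h1 := hh.mulPoly_apply p 1
  rw [mul_one, ← hpq, hh.map_one, ← hh.mulPoly_apply] at h1
  rw [← (hh.lexSupport f).fmul_mulPoly_left hS, ← h1, ← hh.map_one,
    (hh.lexSupport 1).fmul_mulPoly_left hS, hh.map_one, fmul_oneSeries]

end Expansion

/-! ### Comparison of two products expanded in different domains -/

section TwoExpansions

variable {E : Type*} [AddCommGroup E] [Module ℂ E] {φ ψ : ℤ × ℤ ≃+ ℤ ×ₗ ℤ}
  {X X' : ℤ → ℤ → E}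

theorem fmul_diffPow_eq (hφ : ∀ n, LexSupport φ (diffPow n)) (hX : LexSupport φ X) (n : ℤ) (k : ℕ) :
    fmul (diffPow n) X =
      fmul (diffPow (n - k)) ((mulDiff ^ k : Module.End ℂ (ℤ → ℤ → E)) X) := by
  rw [(hφ _).fmul_mulDiff_pow_right hX, ← (hφ _).fmul_mulDiff_pow_left hX, mulDiff_pow_diffPow,
    sub_add_cancel]

theorem fmul_diffPow'_eq (hψ : ∀ n, LexSupport ψ (diffPow' n)) (hX : LexSupport ψ X) (n : ℤ)
    (k : ℕ) :
    fmul (diffPow' n) X =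
      fmul (diffPow' (n - k)) ((mulDiff ^ k : Module.End ℂ (ℤ → ℤ → E)) X) := by
  rw [(hψ _).fmul_mulDiff_pow_right hX, ← (hψ _).fmul_mulDiff_pow_left hX, mulDiff_pow_diffPow',
    sub_add_cancel]

/-- The difference of the two expansions of `(x₁ - x₂)^(n-k) F(x₁, x₂)`. -/
theorem fmul_diffPow_sub_fmul_diffPow' (hφ : ∀ n, LexSupport φ (diffPow n))
    (hψ : ∀ n, LexSupport ψ (diffPow' n)) (hX : LexSupport φ X) (hX' : LexSupport ψ X')
    {F : ℤ → ℤ → E} (hF : DiagFinite F) {k : ℕ}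
    (h : (mulDiff ^ k : Module.End ℂ (ℤ → ℤ → E)) X = F)
    (h' : (mulDiff ^ k : Module.End ℂ (ℤ → ℤ → E)) X' = F) {n : ℤ} {K : ℕ} (hK : k - n ≤ K) :
    fmul (diffPow n) X - fmul (diffPow' n) X' = ∑ j ∈ Finset.range K,
      fmul (deltaDeriv j) (constFst (substTaylor F (k - n - 1 - j))) := by
  have hneg {m : ℤ} (hm : m < 0) : substTaylor F m = 0 := by
    funext b
    exact substTaylor_of_neg F hm b
  have hc0 : constFst (0 : ℤ → E) = 0 := by
    funext a b
    simp [constFst]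
  have hFφ : LexSupport φ F := h ▸ hX.mulDiff_pow k
  have hFψ : LexSupport ψ F := h' ▸ hX'.mulDiff_pow k
  rw [fmul_diffPow_eq hφ hX n k, fmul_diffPow'_eq hψ hX' n k, h, h']
  obtain hn | hn := le_or_gt 0 (n - k)
  -- For `n ≥ k` both expansions are the same polynomial, and every Taylor index on the right is
  -- negative.
  · rw [diffPow_eq_diffPow' hn, sub_self, Finset.sum_eq_zero]
    intro j _
    rw [hneg (by omega), hc0, fmul_zero_right]
  obtain ⟨J, hJ⟩ : ∃ J : ℕ, n - k = -J - 1 := ⟨(k - n - 1).toNat, by omega⟩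
  rw [hJ, ← ((hφ _).summable hFφ).fmul_sub_left ((hψ _).summable hFψ), diffPow_sub_diffPow',
    fmul_deltaDeriv hF, Finset.Nat.sum_antidiagonal_eq_sum_range_succ_mk,
    ← Finset.sum_range_reflect]
  refine (Finset.sum_congr rfl fun j hj => ?_).trans
    (Finset.sum_subset (s₁ := Finset.range (J + 1)) (Finset.range_mono (by omega)) fun j _ hj => ?_)
  · rw [Finset.mem_range] at hj
    dsimp only
    congr 4 <;> omega
  · rw [Finset.mem_range] at hj
    rw [hneg (by omega), hc0, fmul_zero_right]

/-- Multiply by `(x₁ - x₂)^N`: `N ≥ K` kills the delta terms, and `n + N ≥ 0` makes both expansions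
the polynomial `(x₁ - x₂)^t`. -/
theorem mulDiff_pow_eq_of_fmul_diffPow_sub (hφ : ∀ n, LexSupport φ (diffPow n))
    (hψ : ∀ n, LexSupport ψ (diffPow' n)) (hX : LexSupport φ X) (hX' : LexSupport ψ X') {n : ℤ}
    {K : ℕ} {g : ℕ → ℤ → E}
    (h : fmul (diffPow n) X - fmul (diffPow' n) X' =
      ∑ j ∈ Finset.range K, fmul (deltaDeriv j) (constFst (g j))) :
    ∃ t : ℕ, (mulDiff ^ t : Module.End ℂ (ℤ → ℤ → E)) X =
      (mulDiff ^ t : Module.End ℂ (ℤ → ℤ → E)) X' := by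
  obtain ⟨N, t, hN, ht⟩ : ∃ N t : ℕ, K ≤ N ∧ n + N = t :=
    ⟨K + (-n).toNat, (n + (K + (-n).toNat : ℕ)).toNat, by omega, by omega⟩
  refine ⟨t, ?_⟩
  have h1 := congrArg (mulDiff ^ N : Module.End ℂ (ℤ → ℤ → E)) h
  rw [map_sum, Finset.sum_eq_zero fun j hj => mulDiff_pow_fmul_deltaDeriv
      ((Finset.mem_range.1 hj).trans_le hN) (g j), map_sub, sub_eq_zero,
    ← (hφ n).fmul_mulDiff_pow_left hX, ← (hψ n).fmul_mulDiff_pow_left hX', mulDiff_pow_diffPow,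
    mulDiff_pow_diffPow', ht, fmul_diffPow_eq hφ hX _ t, fmul_diffPow'_eq hψ hX' _ t, sub_self,
    ← diffPow_eq_diffPow' le_rfl, diffPow, binomPow_zero, fmul_oneSeries, fmul_oneSeries] at h1
  exact h1

end TwoExpansions

/-! ### Associativity and skew symmetry, common to `V` and `W` -/

section FieldModule

variable {V : Type*} [AddCommGroup V] [Module ℂ V] {A : NonlocalVertexAlgebra V}
  {E : Type*} [AddCommGroup E] [Module ℂ E]

/-- The associativity condition of exponent `k`: the series `(x₁ - x₂)^k Y(u, x₁) Y(v, x₂) w` has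
the Taylor expansion `x₀^k Y(Y(u, x₀) v, x₂) w` at `x₁ = x₂ + x₀`. -/
def AssocAt (A : NonlocalVertexAlgebra V) (ψ : ℤ × ℤ ≃+ ℤ ×ₗ ℤ)
    (Y : V →ₗ[ℂ] ℤ → Module.End ℂ E) (u v : V) (k : ℕ) (w : E) : Prop :=
  DiagFinite ((mulDiff ^ k : Module.End ℂ (ℤ → ℤ → E)) (prod12 (Y u) (Y v) w)) ∧
  LexSupport ψ ((mulDiff ^ k : Module.End ℂ (ℤ → ℤ → E)) (prod12 (Y u) (Y v) w)) ∧
  ∀ a b, substTaylor ((mulDiff ^ k : Module.End ℂ (ℤ → ℤ → E)) (prod12 (Y u) (Y v) w)) a b =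
    Y ((A.Y u).coeff (a - k) v) b w

/-- The common features of a nonlocal vertex algebra as a module over itself and of a
module-at-infinity. -/
structure IsFieldModule (A : NonlocalVertexAlgebra V) (φ ψ : ℤ × ℤ ≃+ ℤ ×ₗ ℤ)
    (Y : V →ₗ[ℂ] ℤ → Module.End ℂ E) : Prop where
  vac_left : ∀ n w, Y A.vac n w = if n = 0 then w else 0
  lexSupport_prod12 : ∀ u v w, LexSupport φ (prod12 (Y u) (Y v) w)
  lexSupport_prod21 : ∀ u v w, LexSupport ψ (prod21 (Y v) (Y u) w)
  assoc : ∀ u v, ∃ k, ∀ w, AssocAt A ψ Y u v k w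

variable {φ ψ : ℤ × ℤ ≃+ ℤ ×ₗ ℤ} {Y : V →ₗ[ℂ] ℤ → Module.End ℂ E}

theorem AssocAt.succ {u v : V} {k : ℕ} {w : E} (h : AssocAt A ψ Y u v k w) :
    AssocAt A ψ Y u v (k + 1) w := by
  obtain ⟨h1, h2, h3⟩ := h
  rw [AssocAt, mulDiff_pow_succ]
  refine ⟨h1.mulDiff, h2.mulDiff, fun a b => ?_⟩
  rw [substTaylor_mulDiff h1, h3, show a - 1 - (k : ℤ) = a - ((k + 1 : ℕ) : ℤ) by push_cast; ring]

theorem AssocAt.mono {u v : V} {k l : ℕ} {w : E} (h : AssocAt A ψ Y u v k w) (hkl : k ≤ l) :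
    AssocAt A ψ Y u v l w := by
  induction l, hkl using Nat.le_induction with
  | base => exact h
  | succ l _ ih => exact ih.succ

/-- `Y(e^{x₀ D} y, x) = Y(y, x + x₀)`, where `e^{x₀ D} y = Y(y, x₀) 1`. -/
theorem IsFieldModule.apply_coeff_vac (hY : IsFieldModule A φ ψ Y) (y : V) (a : ℕ) (b : ℤ)
    (w : E) : Y ((A.Y y).coeff a A.vac) b w = (Ring.choose (b + a) a : ℤ) • Y y (b + a) w := by
  obtain ⟨k, hk⟩ := hY.assoc y A.vac
  -- Since `Y(1, x₂) = 1`, the product is a series in `x₁` alone, and associativity becomes Taylor's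
  -- formula.
  have hS (m n : ℤ) : prod12 (Y y) (Y A.vac) w m n = if n = 0 then Y y m w else 0 := by
    rw [prod12, hY.vac_left]
    split_ifs <;> simp
  have hd : DiagFinite (prod12 (Y y) (Y A.vac) w) := by
    refine fun d => (Set.finite_singleton d).subset fun n hn => ?_
    by_contra h
    refine hn ?_
    rw [hS, if_neg]
    intro h'
    exact h (by simpa using (sub_eq_zero.1 h').symm)
  have h1 := (hk w).2.2 (a + k) b
  rw [substTaylor_mulDiff_pow hd, add_sub_cancel_right, substTaylor_eq_sum (t := {b + (a : ℤ)}),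
    Finset.sum_singleton, hS, sub_self, if_pos rfl, zchoose_natCast] at h1
  · exact h1.symm
  · intro n hn
    rw [hS, if_neg]
    intro h'
    exact hn (by simpa using (sub_eq_zero.1 h').symm)

theorem mulDiff_swapVars (S : ℤ → ℤ → E) : mulDiff (swapVars S) = -swapVars (mulDiff S) := by
  funext a b
  simp [swapVars]

theorem mulDiff_pow_swapVars (k : ℕ) (S : ℤ → ℤ → E) :
    (mulDiff ^ k : Module.End ℂ (ℤ → ℤ → E)) (swapVars S) =
      (-1 : ℂ) ^ k • swapVars ((mulDiff ^ k : Module.End ℂ (ℤ → ℤ → E)) S) := by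
  induction k with
  | zero => simp
  | succ k ih =>
    rw [mulDiff_pow_succ, ih, map_smul, mulDiff_swapVars, mulDiff_pow_succ, pow_succ, mul_smul,
      neg_one_smul]

/-- The coefficients of `x^k e^{xD} Y(v, -x) u`, cut off in negative degrees. -/
def skewSeq (A : NonlocalVertexAlgebra V) (k : ℕ) (u v : V) (a : ℤ) : V :=
  -- The cut-off is harmless: the Taylor expansion has no negative powers of `x₀`, so by
  -- associativity the omitted vectors act as zero.
  if 0 ≤ a then
    (-1 : ℂ) ^ k • ∑ p ∈ Finset.HasAntidiagonal.antidiagonal a.toNat,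
      ((-1) ^ p.1 : ℤ) • (A.Y ((A.Y v).coeff (p.1 - k) u)).coeff p.2 A.vac
  else 0

/-- The interchange formula expresses these Taylor coefficients through those of the other order,
with binomial factors that `apply_coeff_vac` recognizes as the action of `e^{xD}` inside `V`. -/
theorem IsFieldModule.substTaylor_prod21 (hY : IsFieldModule A φ ψ Y) {u v : V} {k : ℕ} {w : E}
    (hk : AssocAt A ψ Y v u k w) (a b : ℤ) :
    substTaylor ((mulDiff ^ k : Module.End ℂ (ℤ → ℤ → E)) (prod21 (Y v) (Y u) w)) a b =
      Y (skewSeq A k u v a) b w := by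
  have hsw : prod21 (Y v) (Y u) w = swapVars (prod12 (Y v) (Y u) w) := rfl
  rw [hsw, mulDiff_pow_swapVars, substTaylor_smul, Pi.smul_apply, Pi.smul_apply]
  obtain ha | ha := lt_or_ge a 0
  · rw [substTaylor_of_neg _ ha, skewSeq, if_neg (by omega)]
    simp
  lift a to ℕ using ha
  rw [substTaylor_swapVars hk.1, skewSeq, if_pos (by omega), Int.toNat_natCast, map_smul, map_sum,
    Pi.smul_apply, LinearMap.smul_apply, Finset.sum_apply, LinearMap.sum_apply]
  congr 1
  refine Finset.sum_congr rfl fun p _ => ?_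
  rw [hk.2.2, map_zsmul, Pi.smul_apply, LinearMap.smul_apply, hY.apply_coeff_vac, mul_smul]

theorem AssocAt.diagFinite_prod21 {u v : V} {k : ℕ} {w : E} (hk : AssocAt A ψ Y v u k w) :
    DiagFinite ((mulDiff ^ k : Module.End ℂ (ℤ → ℤ → E)) (prod21 (Y v) (Y u) w)) := by
  have hsw : prod21 (Y v) (Y u) w = swapVars (prod12 (Y v) (Y u) w) := rfl
  rw [hsw, mulDiff_pow_swapVars]
  exact hk.1.swapVars.smul _

/-- Multiplication by `p(-x)` on series in one variable. -/
abbrev seqPoly (p : Polynomial ℂ) : Module.End ℂ (ℤ → V) :=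
  Polynomial.aeval (-LinearMap.funLeft ℂ V (fun a : ℤ => a - 1)) p

theorem seqPoly_add (p q : Polynomial ℂ) (ξ : ℤ → V) :
    seqPoly (p + q) ξ = seqPoly p ξ + seqPoly q ξ := by
  rw [seqPoly, map_add, LinearMap.add_apply]

theorem seqPoly_smul (c : ℂ) (p : Polynomial ℂ) (ξ : ℤ → V) :
    seqPoly (c • p) ξ = c • seqPoly p ξ := by
  rw [seqPoly, map_smul, LinearMap.smul_apply]

theorem seqPoly_X_mul_apply (p : Polynomial ℂ) (ξ : ℤ → V) (a : ℤ) :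
    seqPoly (Polynomial.X * p) ξ a = -seqPoly p ξ (a - 1) := by
  rw [seqPoly, map_mul, Polynomial.aeval_X, Module.End.mul_apply, LinearMap.neg_apply,
    Pi.neg_apply, LinearMap.funLeft_apply]

theorem substTaylor_mulPoly {S : ℤ → ℤ → E} (hS : DiagFinite S) {ξ : ℤ → V} {w : E}
    (h : ∀ a b, substTaylor S a b = Y (ξ a) b w) (p : Polynomial ℂ) :
    DiagFinite (mulPoly p S) ∧
      ∀ a b, substTaylor (mulPoly p S) a b = Y (seqPoly p ξ a) b w := by
  refine mulPoly_induction (P := fun p S => DiagFinite S ∧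
    ∀ a b, substTaylor S a b = Y (seqPoly p ξ a) b w) ⟨hS, by simpa using h⟩ ?_ ?_ ?_ p
  · rintro p q S T ⟨h1, h1'⟩ ⟨h2, h2'⟩
    refine ⟨h1.add h2, fun a b => ?_⟩
    rw [substTaylor_add h1 h2, Pi.add_apply, Pi.add_apply, h1', h2', seqPoly_add]
    simp
  · rintro c p S ⟨h1, h1'⟩
    refine ⟨h1.smul c, fun a b => ?_⟩
    rw [substTaylor_smul, Pi.smul_apply, Pi.smul_apply, h1', seqPoly_smul]
    simp
  · rintro p S ⟨h1, h1'⟩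
    refine ⟨h1.mulDiff.neg, fun a b => ?_⟩
    rw [substTaylor_neg, Pi.neg_apply, Pi.neg_apply, substTaylor_mulDiff h1, h1',
      seqPoly_X_mul_apply]
    simp

end FieldModule

/-! ### The relation as a condition on vectors of `V` -/

section Relation

variable {V : Type*} [AddCommGroup V] [Module ℂ V] {A : NonlocalVertexAlgebra V}
  {E : Type*} [AddCommGroup E] [Module ℂ E] {φ ψ : ℤ × ℤ ≃+ ℤ ×ₗ ℤ}
  {Y : V →ₗ[ℂ] ℤ → Module.End ℂ E} {h : RatFunc ℂ →ₗ[ℂ] ℤ → ℤ → ℂ} {k : ℕ} {u v : V} {r : ℕ}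
  {us vs : Fin r → V} {f : Fin r → RatFunc ℂ} {p : Fin r → Polynomial ℂ} {q : Polynomial ℂ} {w : E}

/-- The coefficients of `x^k` times the obstruction
`q(-x) Y(u, x) v - ∑ᵢ pᵢ(-x) e^{xD} Y(v⁽ⁱ⁾, -x) u⁽ⁱ⁾` to skew symmetry. -/
def skewObstruction (A : NonlocalVertexAlgebra V) (k : ℕ) (u v : V) (us vs : Fin r → V)
    (q : Polynomial ℂ) (p : Fin r → Polynomial ℂ) : ℤ → V :=
  seqPoly q (fun a => (A.Y u).coeff (a - k) v) - ∑ i, seqPoly (p i) (skewSeq A k (us i) (vs i))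

/-- `∑ᵢ fᵢ(x₂ - x₁) Y(v⁽ⁱ⁾, x₂) Y(u⁽ⁱ⁾, x₁) w`. -/
def braidedProd (h : RatFunc ℂ →ₗ[ℂ] ℤ → ℤ → ℂ) (Y : V →ₗ[ℂ] ℤ → Module.End ℂ E)
    (us vs : Fin r → V) (f : Fin r → RatFunc ℂ) (w : E) : ℤ → ℤ → E :=
  ∑ i, fmul (h (f i)) (prod21 (Y (vs i)) (Y (us i)) w)

theorem IsFieldModule.lexSupport_braidedProd (hY : IsFieldModule A φ ψ Y) (hh : IsExpansion ψ h) :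
    LexSupport ψ (braidedProd h Y us vs f w) :=
  LexSupport.sum fun _ _ => (hh.lexSupport _).fmul (hY.lexSupport_prod21 _ _ _)

theorem IsFieldModule.mulPoly_braidedProd (hY : IsFieldModule A φ ψ Y) (hh : IsExpansion ψ h)
    (hp : ∀ i, algebraMap _ _ q * f i = algebraMap _ _ (p i)) :
    mulPoly q (braidedProd h Y us vs f w) =
      ∑ i, mulPoly (p i) (prod21 (Y (vs i)) (Y (us i)) w) := by
  rw [braidedProd, map_sum]
  exact Finset.sum_congr rfl fun i _ => hh.mulPoly_fmul (hp i) (hY.lexSupport_prod21 _ _ _)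

omit [Module ℂ E] in
theorem DiagFinite.sum {ι : Type*} {s : Finset ι} {S : ι → ℤ → ℤ → E}
    (hS : ∀ i, DiagFinite (S i)) : DiagFinite (∑ i ∈ s, S i) := by
  classical
  induction s using Finset.induction_on with
  | empty => exact DiagFinite.zero
  | insert i s hi ih =>
    rw [Finset.sum_insert hi]
    exact (hS i).add ih

omit [Module ℂ E] in
theorem substTaylor_sum {ι : Type*} {s : Finset ι} {S : ι → ℤ → ℤ → E}
    (hS : ∀ i, DiagFinite (S i)) (a b : ℤ) :
    substTaylor (∑ i ∈ s, S i) a b = ∑ i ∈ s, substTaylor (S i) a b := by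
  classical
  induction s using Finset.induction_on with
  | empty => simp [substTaylor]
  | insert i s hi ih =>
    rw [Finset.sum_insert hi, substTaylor_add (hS i) (DiagFinite.sum hS), Pi.add_apply,
      Pi.add_apply, ih, Finset.sum_insert hi]

/-- The Taylor coefficients of
`(x₁ - x₂)^k (q(x₂ - x₁) Y(u, x₁) Y(v, x₂) w - ∑ᵢ pᵢ(x₂ - x₁) Y(v⁽ⁱ⁾, x₂) Y(u⁽ⁱ⁾, x₁) w)`. -/
theorem IsFieldModule.substTaylor_skewObstruction (hY : IsFieldModule A φ ψ Y)
    (hk : AssocAt A ψ Y u v k w) (hk' : ∀ i, AssocAt A ψ Y (vs i) (us i) k w)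
    (q : Polynomial ℂ) (p : Fin r → Polynomial ℂ) :
    DiagFinite ((mulDiff ^ k : Module.End ℂ (ℤ → ℤ → E)) (mulPoly q (prod12 (Y u) (Y v) w) -
        ∑ i, mulPoly (p i) (prod21 (Y (vs i)) (Y (us i)) w))) ∧
      ∀ a b, substTaylor ((mulDiff ^ k : Module.End ℂ (ℤ → ℤ → E))
        (mulPoly q (prod12 (Y u) (Y v) w) -
          ∑ i, mulPoly (p i) (prod21 (Y (vs i)) (Y (us i)) w))) a b =
        Y (skewObstruction A k u v us vs q p a) b w := by
  have h1 := substTaylor_mulPoly hk.1 (ξ := fun a => (A.Y u).coeff (a - k) v) hk.2.2 q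
  have h2 i := substTaylor_mulPoly (hk' i).diagFinite_prod21 (hY.substTaylor_prod21 (hk' i)) (p i)
  simp only [map_sub, map_sum, ← mulPoly_mulDiff_pow]
  refine ⟨h1.1.sub (DiagFinite.sum fun i => (h2 i).1), fun a b => ?_⟩
  rw [substTaylor_sub h1.1 (DiagFinite.sum fun i => (h2 i).1), Pi.sub_apply, Pi.sub_apply, h1.2,
    substTaylor_sum (fun i => (h2 i).1), skewObstruction, Pi.sub_apply, map_sub,
    Finset.sum_apply, map_sum, Pi.sub_apply, Finset.sum_apply, LinearMap.sub_apply,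
    LinearMap.sum_apply]
  simp only [fun i => (h2 i).2]

/-- After clearing denominators, the difference of the products times `(x₁ - x₂)^k` is finite in
each degree and annihilated by `(x₁ - x₂)^t`, hence zero. -/
theorem IsFieldModule.skewObstruction_eq_zero (hY : IsFieldModule A φ ψ Y) (hh : IsExpansion ψ h)
    (hk : AssocAt A ψ Y u v k w) (hk' : ∀ i, AssocAt A ψ Y (vs i) (us i) k w)
    (hp : ∀ i, algebraMap _ _ q * f i = algebraMap _ _ (p i)) {t : ℕ}
    (ht : (mulDiff ^ t : Module.End ℂ (ℤ → ℤ → E)) (prod12 (Y u) (Y v) w) =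
      (mulDiff ^ t : Module.End ℂ (ℤ → ℤ → E)) (braidedProd h Y us vs f w)) (a b : ℤ) :
    Y (skewObstruction A k u v us vs q p a) b w = 0 := by
  obtain ⟨h1, h2⟩ := hY.substTaylor_skewObstruction hk hk' q p
  rw [← h2, eq_zero_of_mulDiff_pow_eq_zero h1 (k := t)]
  · simp [substTaylor]
  rw [← Module.End.mul_apply, ← pow_add, add_comm, pow_add, Module.End.mul_apply, map_sub,
    ← mulPoly_mulDiff_pow, ht, mulPoly_mulDiff_pow, hY.mulPoly_braidedProd hh hp, sub_self,
    map_zero]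

/-- Vanishing Taylor coefficients give the equality multiplied by `q(x₂ - x₁)`; this factor cancels
because both sides have support well-ordered along `ψ`, where `1/q` has an expansion. -/
theorem IsFieldModule.mulDiff_pow_braidedProd (hY : IsFieldModule A φ ψ Y) (hh : IsExpansion ψ h)
    (hk : AssocAt A ψ Y u v k w) (hk' : ∀ i, AssocAt A ψ Y (vs i) (us i) k w)
    (hq : q ≠ 0) (hp : ∀ i, algebraMap _ _ q * f i = algebraMap _ _ (p i))
    (h0 : ∀ a b, Y (skewObstruction A k u v us vs q p a) b w = 0) :
    (mulDiff ^ k : Module.End ℂ (ℤ → ℤ → E)) (braidedProd h Y us vs f w) =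
      (mulDiff ^ k : Module.End ℂ (ℤ → ℤ → E)) (prod12 (Y u) (Y v) w) := by
  obtain ⟨h1, h2⟩ := hY.substTaylor_skewObstruction hk hk' q p
  have h3 := eq_zero_of_substTaylor_eq_zero h1 (by
    funext a b
    rw [h2, h0]
    rfl)
  rw [← sub_eq_zero]
  refine hh.eq_zero_of_mulPoly_eq_zero hq
    (((hY.lexSupport_braidedProd hh).mulDiff_pow k).sub hk.2.1) ?_
  rw [map_sub, mulPoly_mulDiff_pow, mulPoly_mulDiff_pow, hY.mulPoly_braidedProd hh hp, ← map_sub,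
    ← neg_sub, map_neg, h3, neg_zero]

/-- The vector `c⁽ʲ⁾`, extended by zero to all `j`. -/
def extendFin {s : ℕ} (c : Fin (s + 1) → V) (j : ℕ) : V := if h : j < s + 1 then c ⟨j, h⟩ else 0

theorem sum_fmul_deltaDeriv_extendFin {s : ℕ} (c : Fin (s + 1) → V) {K : ℕ} (hK : s + 1 ≤ K) :
    ∑ j : Fin (s + 1), fmul (deltaDeriv j) (constFst fun b => Y (c j) b w) =
      ∑ j ∈ Finset.range K, fmul (deltaDeriv j) (constFst fun b => Y (extendFin c j) b w) := by
  rw [← Finset.sum_subset (Finset.range_mono hK), Finset.sum_range]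
  · refine Finset.sum_congr rfl fun j _ => ?_
    simp only [extendFin, dif_pos j.2]
  · intro j _ hj
    rw [Finset.mem_range] at hj
    funext a b
    simp [fmul_deltaDeriv_constFst, extendFin, hj]

/-- A commutator relation between two expansions holds if and only if skew symmetry holds, and the
singular part of `x^n Y(u, x) v` is as prescribed. Here `X`, `X'` are the two products, in
either order. -/
theorem relation_iff {φ' ψ' : ℤ × ℤ ≃+ ℤ ×ₗ ℤ} {X X' F : ℤ → ℤ → E} {s : ℕ} {n : ℤ}
    {c : Fin (s + 1) → V} {P : Prop} (hφ : ∀ n, LexSupport φ' (diffPow n))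
    (hψ : ∀ n, LexSupport ψ' (diffPow' n)) (hX : LexSupport φ' X) (hX' : LexSupport ψ' X')
    (hF : DiagFinite F) (hFY : ∀ a b, substTaylor F a b = Y ((A.Y u).coeff (a - k) v) b w)
    (h1 : ∀ t : ℕ, (mulDiff ^ t : Module.End ℂ (ℤ → ℤ → E)) X =
      (mulDiff ^ t : Module.End ℂ (ℤ → ℤ → E)) X' → P)
    (h2 : P → (mulDiff ^ k : Module.End ℂ (ℤ → ℤ → E)) X = F ∧
      (mulDiff ^ k : Module.End ℂ (ℤ → ℤ → E)) X' = F) :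
    fmul (diffPow n) X - fmul (diffPow' n) X' =
        ∑ j : Fin (s + 1), fmul (deltaDeriv j) (constFst fun b => Y (c j) b w) ↔
      P ∧ ∀ (j : ℕ) (b : ℤ), Y ((A.Y u).coeff (-n - 1 - j) v - extendFin c j) b w = 0 := by
  obtain ⟨K, hK1, hK2⟩ : ∃ K : ℕ, s + 1 ≤ K ∧ k - n ≤ K :=
    ⟨s + 1 + (k - n).toNat, by omega, by omega⟩
  have hT (j : ℕ) : substTaylor F (k - n - 1 - j) =
      fun b => Y ((A.Y u).coeff (-n - 1 - j) v) b w := by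
    funext b
    rw [hFY, show (k : ℤ) - n - 1 - j - k = -n - 1 - j by ring]
  rw [sum_fmul_deltaDeriv_extendFin c hK1]
  constructor
  · intro h
    obtain ⟨t, ht⟩ := mulDiff_pow_eq_of_fmul_diffPow_sub hφ hψ hX hX' h
    have hP := h1 t ht
    refine ⟨hP, fun j b => ?_⟩
    rw [map_sub, Pi.sub_apply, LinearMap.sub_apply]
    obtain hj | hj := lt_or_ge j K
    · rw [fmul_diffPow_sub_fmul_diffPow' hφ hψ hX hX' hF (h2 hP).1 (h2 hP).2 hK2, ← sub_eq_zero,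
        ← Finset.sum_sub_distrib] at h
      have h3 := eq_zero_of_sum_fmul_deltaDeriv_eq_zero (K := K)
        (g := fun j b => Y ((A.Y u).coeff (-n - 1 - j) v) b w - Y (extendFin c j) b w) (by
          rw [← h]
          refine Finset.sum_congr rfl fun j _ => ?_
          funext a b
          simp only [Pi.sub_apply, fmul_deltaDeriv_constFst, hT, smul_sub]) hj
      exact congrFun h3 b
    -- For `j ≥ K` the Taylor index `k - n - 1 - j` is negative and `c⁽ʲ⁾` is zero by convention.
    · rw [← congrFun (hT j) b, substTaylor_of_neg _ (by omega), extendFin, dif_neg (by omega)]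
      simp
  · rintro ⟨hP, h3⟩
    rw [fmul_diffPow_sub_fmul_diffPow' hφ hψ hX hX' hF (h2 hP).1 (h2 hP).2 hK2]
    refine Finset.sum_congr rfl fun j _ => ?_
    rw [hT]
    congr 2
    funext b
    have := h3 j b
    rwa [map_sub, Pi.sub_apply, LinearMap.sub_apply, sub_eq_zero] at this

end Relation

/-! ### From weak associativity to the form with `(x₁ - x₂)^k` -/

section Associativity

variable {E : Type*} [AddCommGroup E] [Module ℂ E]

/-- Multiplication by `x₁ + x₂`. -/
def mulSum : (ℤ → ℤ → E) →ₗ[ℂ] (ℤ → ℤ → E) := shift 1 0 + shift 0 1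

theorem mulSum_eq (S : ℤ → ℤ → E) : mulSum S = shift 1 0 S + shift 0 1 S := rfl

theorem mulSum_apply (S : ℤ → ℤ → E) (a b : ℤ) : mulSum S a b = S (a - 1) b + S a (b - 1) := by
  simp [mulSum]

theorem fmul_binomPow_one_one (l : ℕ) (S : ℤ → ℤ → E) :
    fmul (binomPow 1 1 l) S = (mulSum ^ l : Module.End ℂ (ℤ → ℤ → E)) S := by
  have hs (l : ℕ) : MulSummable (binomPow 1 1 l) S := by
    intro a b
    refine ((Set.finite_Icc (0 : ℤ) l).image fun n => ((l : ℤ) - n, n)).subset ?_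
    rintro ⟨m, n⟩ ⟨h, -⟩
    rw [binomPow_eq] at h
    simp only [ne_eq, ite_eq_right_iff, Classical.not_imp] at h
    refine ⟨n, ?_, Prod.ext (by dsimp; omega) rfl⟩
    by_contra h'
    rw [Set.mem_Icc] at h'
    obtain h0 | h0 := lt_or_ge n 0
    · exact h.2 (by simp [zchoose_of_neg h0])
    · exact h.2 (by simp [zchoose_of_lt (show (0 : ℤ) ≤ l by omega) (show (l : ℤ) < n by omega)])
  induction l with
  | zero => simp [binomPow_zero]
  | succ l ih =>
    rw [Nat.cast_succ, shift_binomPow one_ne_zero one_ne_zero, one_smul, one_smul,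
      ((hs l).shift_left 1 0).fmul_add_left ((hs l).shift_left 0 1), fmul_shift_left,
      fmul_shift_left, ih, pow_succ', Module.End.mul_apply, mulSum_eq]

/-- The exponents of the second variable in `S` are at least `B`. -/
def BddSnd (B : ℤ) (S : ℤ → ℤ → E) : Prop := ∀ a b, b < B → S a b = 0

/-- The exponents of the first variable in `S` are nonnegative. -/
def NonnegFst (S : ℤ → ℤ → E) : Prop := ∀ a b, a < 0 → S a b = 0

variable {B : ℤ} {S T : ℤ → ℤ → E}

theorem BddSnd.mulDiff_pow (hS : BddSnd B S) (k : ℕ) :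
    BddSnd B ((mulDiff ^ k : Module.End ℂ (ℤ → ℤ → E)) S) := by
  induction k with
  | zero => exact hS
  | succ k ih =>
    intro a b hb
    rw [mulDiff_pow_succ, mulDiff_apply, ih _ _ hb, ih _ _ (by omega), sub_zero]

theorem NonnegFst.mulSum_pow (hS : NonnegFst S) (l : ℕ) :
    NonnegFst ((mulSum ^ l : Module.End ℂ (ℤ → ℤ → E)) S) := by
  induction l with
  | zero => exact hS
  | succ k ih =>
    intro a b ha
    rw [pow_succ', Module.End.mul_apply, mulSum_apply, ih _ _ ha, ih _ _ (by omega), add_zero]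

/-- The lowest power of `x₁` in `(x₁ + x₂) S` comes from `x₂ S` alone. Without a lowest power, `∑ₙ
(-1)^n x₁^n x₂^(-n)` is a counterexample. -/
theorem NonnegFst.eq_zero_of_mulSum_pow_eq_zero (hS : NonnegFst S) {l : ℕ}
    (h : (mulSum ^ l : Module.End ℂ (ℤ → ℤ → E)) S = 0) : S = 0 := by
  induction l with
  | zero => exact h
  | succ l ih =>
    rw [pow_succ', Module.End.mul_apply] at h
    refine ih ?_
    have hl := hS.mulSum_pow l
    generalize (mulSum ^ l : Module.End ℂ (ℤ → ℤ → E)) S = S' at h hl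
    have main (n : ℕ) : ∀ b, S' n b = 0 := by
      induction n with
      | zero =>
        intro b
        have := congrFun (congrFun h 0) (b + 1)
        rw [mulSum_apply, hl _ _ (by omega)] at this
        simpa using this
      | succ n ihn =>
        intro b
        have := congrFun (congrFun h (n + 1)) (b + 1)
        rw [mulSum_apply, add_sub_cancel_right, ihn] at this
        simpa using this
    funext a b
    obtain ha | ha := lt_or_ge a 0
    · exact hl _ _ ha
    · lift a to ℕ using ha
      exact main a b

omit [Module ℂ E] in
theorem BddSnd.substFst_eq_sum (hS : BddSnd B S) {b : ℤ} {N : ℕ} (hN : b - B < N) (a : ℤ) :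
    substFst S a b = ∑ i ∈ Finset.range N, (Ring.choose (a + i) i : ℤ) • S (a + i) (b - i) := by
  refine finsum_eq_sum_of_support_subset _ fun i hi => ?_
  by_contra h
  refine hi ?_
  simp only [Finset.coe_range, Set.mem_Iio, not_lt] at h
  dsimp only
  rw [hS _ _ (by omega), smul_zero]

theorem substFst_shift_snd (S : ℤ → ℤ → E) : substFst (shift 0 1 S) = shift 0 1 (substFst S) := by
  funext a b
  simp only [substFst, shift_apply, sub_zero]
  exact finsum_congr fun i => by rw [sub_right_comm]

theorem BddSnd.substFst_shift_fst (hS : BddSnd B S) :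
    substFst (shift 1 0 S) = mulSum (substFst S) := by
  have hS' : BddSnd B (shift 1 0 S) := fun a b hb => hS _ _ (by omega)
  funext a b
  have hN : b - B < ((b - B + 1).toNat + 1 : ℕ) := by push_cast; omega
  rw [mulSum_apply, hS'.substFst_eq_sum hN, hS.substFst_eq_sum hN,
    hS.substFst_eq_sum (N := (b - B + 1).toNat) (by omega), Finset.sum_range_succ',
    Finset.sum_range_succ', add_right_comm, ← Finset.sum_add_distrib]
  congr 1
  · refine Finset.sum_congr rfl fun i _ => ?_
    rw [shift_apply, Nat.cast_succ, ← add_assoc, Ring.choose_succ_succ,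
      show a - 1 + ((i : ℤ) + 1) = a + i by ring, show a + (i : ℤ) + 1 - 1 = a + i by ring,
      show b - ((i : ℤ) + 1) - 0 = b - 1 - i by ring, show b - ((i : ℤ) + 1) = b - 1 - i by ring,
      add_smul, add_comm]
  · simp

theorem BddSnd.substFst_mulDiff (hS : BddSnd B S) :
    substFst (mulDiff S) = shift 1 0 (substFst S) := by
  have h1 : BddSnd B (shift 1 0 S) := fun a b hb => hS _ _ (by omega)
  have h2 : BddSnd B (shift 0 1 S) := fun a b hb => hS _ _ (by omega)
  have h3 : BddSnd B (mulDiff S) := hS.mulDiff_pow 1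
  have h4 : substFst (mulDiff S) = substFst (shift 1 0 S) - substFst (shift 0 1 S) := by
    funext a b
    have hN : b - B < ((b - B + 1).toNat : ℕ) := by omega
    rw [Pi.sub_apply, Pi.sub_apply, h3.substFst_eq_sum hN, h1.substFst_eq_sum hN,
      h2.substFst_eq_sum hN, ← Finset.sum_sub_distrib]
    exact Finset.sum_congr rfl fun i _ => by rw [mulDiff_eq, Pi.sub_apply, Pi.sub_apply, smul_sub]
  rw [h4, hS.substFst_shift_fst, substFst_shift_snd, mulSum_eq, add_sub_cancel_right]

theorem BddSnd.substFst_mulDiff_pow (hS : BddSnd B S) (k : ℕ) :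
    substFst ((mulDiff ^ k : Module.End ℂ (ℤ → ℤ → E)) S) = shift k 0 (substFst S) := by
  induction k with
  | zero =>
    funext a b
    simp
  | succ k ih =>
    rw [mulDiff_pow_succ, (hS.mulDiff_pow k).substFst_mulDiff, ih, shift_shift]
    congr 2
    push_cast
    ring

theorem BddSnd.shift_nat (hS : BddSnd B S) (l : ℕ) : BddSnd B (shift l 0 S) :=
  fun _ _ hb => hS _ _ (by omega)

theorem shift_succ (l : ℕ) (S : ℤ → ℤ → E) :
    shift ((l + 1 : ℕ) : ℤ) 0 S = shift 1 0 (shift l 0 S) := by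
  rw [shift_shift, Nat.cast_succ, add_comm (l : ℤ), add_zero]

theorem BddSnd.substFst_shift (hS : BddSnd B S) (l : ℕ) :
    substFst (shift l 0 S) = (mulSum ^ l : Module.End ℂ (ℤ → ℤ → E)) (substFst S) := by
  induction l with
  | zero =>
    have : shift (0 : ℕ) 0 S = S := by funext a b; simp
    rw [this]
    rfl
  | succ l ih =>
    rw [shift_succ, (hS.shift_nat l).substFst_shift_fst, ih, pow_succ', Module.End.mul_apply]

theorem substTaylor_shift_nat (hS : DiagFinite S) (l : ℕ) :
    substTaylor (shift l 0 S) = (mulSum ^ l : Module.End ℂ (ℤ → ℤ → E)) (substTaylor S) := by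
  induction l with
  | zero =>
    have : shift (0 : ℕ) 0 S = S := by funext a b; simp
    rw [this]
    rfl
  | succ l ih =>
    funext a b
    rw [shift_succ, substTaylor_shift_fst (hS.shift _ _), ih, pow_succ', Module.End.mul_apply,
      mulSum_apply, add_comm]

omit [Module ℂ E] in
/-- If the result of the substitution `x₁ = x₀ + x₂` has nonnegative powers of `x₀` only, then
already `S` has nonnegative powers of `x₁` only. -/
theorem BddSnd.nonnegFst (hS : BddSnd B S) (h : NonnegFst (substFst S)) : NonnegFst S := by
  -- Induction on the exponent of `x₂`: terms with `i > 0` have a smaller one, or have `0 ≤ a + i <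
  -- i`, where the binomial coefficient vanishes.
  have main (m : ℕ) : ∀ a b, b < B + m → a < 0 → S a b = 0 := by
    induction m with
    | zero => exact fun a b hb _ => hS a b (by omega)
    | succ m ih =>
      intro a b hb ha
      have h1 := h a b ha
      rw [hS.substFst_eq_sum (N := m + 1) (by push_cast at hb ⊢; omega),
        Finset.sum_eq_single_of_mem 0 (by simp)] at h1
      · simpa using h1
      · intro i _ hi
        obtain h2 | h2 := lt_or_ge (a + i) 0
        · rw [ih _ _ (by push_cast at hb; omega) h2, smul_zero]
        · rw [← zchoose_natCast, zchoose_of_lt h2 (by omega), zero_smul]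
  exact fun a b ha => main (b - B + 1).toNat a b (by omega) ha

omit [Module ℂ E] in
-- Nonnegative powers of `x₀ + x₂` are polynomials, for which the order of expansion is irrelevant.
theorem BddSnd.substFst_eq_substTaylor (hS : BddSnd B S) (h : NonnegFst S) :
    substFst S = substTaylor S := by
  funext a b
  obtain ⟨N, hN⟩ : ∃ N : ℕ, b - B < N := ⟨(b - B + 1).toNat, by omega⟩
  rw [hS.substFst_eq_sum hN, substTaylor_eq_sum (t := Finset.Ico 0 (a + N))]
  swap
  · intro n hn
    rw [Finset.mem_Ico] at hn
    by_cases h0 : n < 0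
    · exact h _ _ h0
    · exact hS _ _ (by omega)
  have h1 : ∑ i ∈ Finset.range N, (Ring.choose (a + i) i : ℤ) • S (a + i) (b - i) =
      ∑ n ∈ Finset.Ico a (a + N), zchoose n (n - a) • S n (b + a - n) := by
    refine Finset.sum_bij (fun i _ => a + (i : ℤ)) (fun i hi => ?_) (fun i _ j _ hij => ?_)
      (fun n hn => ?_) (fun i _ => ?_)
    · rw [Finset.mem_range] at hi
      rw [Finset.mem_Ico]
      omega
    · omega
    · rw [Finset.mem_Ico] at hn
      exact ⟨(n - a).toNat, by rw [Finset.mem_range]; omega, by omega⟩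
    · rw [add_sub_cancel_left, zchoose_natCast]
      congr 2
      ring
  rw [h1]
  obtain ha | ha := lt_or_ge a 0
  · rw [Finset.sum_eq_zero, Finset.sum_eq_zero]
    · intro n _
      rw [zchoose_of_neg ha, zero_smul]
    · intro n _
      obtain hn | hn := lt_or_ge n 0
      · rw [h _ _ hn, smul_zero]
      · rw [zchoose_of_lt hn (by omega), zero_smul]
  · rw [← Finset.sum_subset (Finset.Ico_subset_Ico_left ha)]
    · refine Finset.sum_congr rfl fun n hn => ?_
      rw [Finset.mem_Ico] at hn
      rw [zchoose_symm (by omega)]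
    · intro n hn hn'
      rw [Finset.mem_Ico] at hn hn'
      rw [zchoose_of_lt hn.1 (by omega), zero_smul]

/-- Weak associativity implies that `(x₁ - x₂)^k S(x₁, x₂)` is bounded below, with an exponent `k`
which only depends on the order of the pole of `T(x₀, x₂)` at `x₀ = 0`. -/
theorem BddSnd.boundedBelow_and_substTaylor (hS : BddSnd B S) {k l : ℕ}
    (hT : ∀ a b : ℤ, a < -k → T a b = 0)
    (h : (mulSum ^ l : Module.End ℂ (ℤ → ℤ → E)) (substFst S) =
      (mulSum ^ l : Module.End ℂ (ℤ → ℤ → E)) T) :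
    BoundedBelow ((mulDiff ^ k : Module.End ℂ (ℤ → ℤ → E)) S) ∧
      ∀ a b, substTaylor ((mulDiff ^ k : Module.End ℂ (ℤ → ℤ → E)) S) a b = T (a - k) b := by
  have hc (T : ℤ → ℤ → E) : (mulSum ^ l : Module.End ℂ (ℤ → ℤ → E)) (shift k 0 T) =
      shift k 0 ((mulSum ^ l : Module.End ℂ (ℤ → ℤ → E)) T) := by
    clear h
    induction l with
    | zero => rfl
    | succ l ih =>
      rw [pow_succ', Module.End.mul_apply, Module.End.mul_apply, ih, mulSum_eq, mulSum_eq, map_add]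
      simp only [shift_shift, add_comm]
  have hT' : NonnegFst (shift k 0 T) := fun a b ha => hT _ _ (by omega)
  set F := (mulDiff ^ k : Module.End ℂ (ℤ → ℤ → E)) S with hF
  have hFB : BddSnd B F := hS.mulDiff_pow k
  -- Substituting `x₁ = x₀ + x₂` in `x₁^l (x₁ - x₂)^k S` gives `(x₀ + x₂)^l x₀^k T`, which has no
  -- negative power of `x₀`.
  have h1 : substFst (shift l 0 F) = (mulSum ^ l : Module.End ℂ (ℤ → ℤ → E)) (shift k 0 T) := by
    rw [hFB.substFst_shift, hF, hS.substFst_mulDiff_pow, hc, h, ← hc]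
  have hnn : NonnegFst (shift l 0 F) := by
    refine (hFB.shift_nat l).nonnegFst ?_
    rw [h1]
    exact hT'.mulSum_pow l
  have hbdd : BoundedBelow F := by
    refine ⟨min (-l) B, fun a b hab => ?_⟩
    obtain ha | hb := hab
    · have := hnn (a + l) b (by omega)
      rw [shift_apply] at this
      simpa using this
    · exact hFB _ _ (by omega)
  refine ⟨hbdd, fun a b => ?_⟩
  rw [(hFB.shift_nat l).substFst_eq_substTaylor hnn, substTaylor_shift_nat hbdd.diagFinite,
    ← sub_eq_zero, ← map_sub] at h1
  have h2 := NonnegFst.eq_zero_of_mulSum_pow_eq_zero (fun a b ha => by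
    rw [Pi.sub_apply, Pi.sub_apply, hT' _ _ ha, substTaylor_of_neg _ ha, sub_zero]) h1
  have h3 := congrFun (congrFun h2 a) b
  rw [Pi.sub_apply, Pi.sub_apply, shift_apply, sub_zero] at h3
  exact sub_eq_zero.1 h3

end Associativity

/-! ### The four domains of expansion -/

section Orders

/-- The lexicographic order of exponents, after the automorphism `e` of `ℤ × ℤ`. -/
def lexOf (e : ℤ × ℤ ≃+ ℤ × ℤ) : ℤ × ℤ ≃+ ℤ ×ₗ ℤ := e.trans (toLexAddEquiv (ℤ × ℤ))

theorem lexSupport_lexOf {E : Type*} [AddCommGroup E] {e : ℤ × ℤ ≃+ ℤ × ℤ} {S : ℤ → ℤ → E}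
    (h1 : ∃ N, ∀ p : ℤ × ℤ, (e p).1 < N → S p.1 p.2 = 0)
    (h2 : ∀ a, ∃ N, ∀ p : ℤ × ℤ, (e p).1 = a → (e p).2 < N → S p.1 p.2 = 0) :
    LexSupport (lexOf e) S := by
  refine Set.PartiallyWellOrderedOn.subsetProdLex ?_ fun a => ?_
  · obtain ⟨N, hN⟩ := h1
    refine (BddBelow.isWF ⟨N, ?_⟩).isPWO
    rintro _ ⟨_, ⟨p, hp, rfl⟩, rfl⟩
    exact not_lt.1 fun h => hp (hN p h)
  · obtain ⟨N, hN⟩ := h2 a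
    refine (BddBelow.isWF ⟨N, ?_⟩).isPWO
    rintro b ⟨p, hp, hpb⟩
    have hpb' : e p = (a, b) := toLex.injective hpb
    refine not_lt.1 fun h => hp (hN p ?_ ?_) <;> rw [hpb']
    exact h

/-- Well-ordered supports for `lexBelow` are those of series in `E((x₂))((x₁))`. -/
abbrev lexBelow : ℤ × ℤ ≃+ ℤ ×ₗ ℤ := lexOf (AddEquiv.refl _)

/-- Well-ordered supports for `lexBelow'` are those of series in `E((x₁))((x₂))`. -/
abbrev lexBelow' : ℤ × ℤ ≃+ ℤ ×ₗ ℤ := lexOf AddEquiv.prodComm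

/-- Well-ordered supports for `lexAbove` are those of series in `E((x₂⁻¹))((x₁⁻¹))`. -/
abbrev lexAbove : ℤ × ℤ ≃+ ℤ ×ₗ ℤ := lexOf (AddEquiv.neg _)

/-- Well-ordered supports for `lexAbove'` are those of series in `E((x₁⁻¹))((x₂⁻¹))`. -/
abbrev lexAbove' : ℤ × ℤ ≃+ ℤ ×ₗ ℤ := lexOf (AddEquiv.prodComm.trans (AddEquiv.neg _))

theorem diffPow_eq_zero {n a b : ℤ} (h : b < 0 ∨ a + b ≠ n) : diffPow n a b = 0 := by
  rw [diffPow_apply]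
  obtain h | h := h
  · simp [zchoose_of_neg h]
  · simp [h]

theorem diffPow'_eq_zero {n a b : ℤ} (h : a < 0 ∨ a + b ≠ n) : diffPow' n a b = 0 := by
  rw [diffPow'_apply]
  obtain h | h := h
  · simp [zchoose_of_neg h]
  · simp [h]

theorem lexSupport_diffPow_below (n : ℤ) : LexSupport lexBelow' (diffPow n) := by
  refine lexSupport_lexOf ⟨0, ?_⟩ fun c => ⟨n - c, ?_⟩
  · rintro ⟨a, b⟩ h
    exact diffPow_eq_zero (Or.inl h)
  · rintro ⟨a, b⟩ h h'
    refine diffPow_eq_zero (Or.inr ?_)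
    change b = c at h
    change a < _ at h'
    dsimp only
    omega

theorem lexSupport_diffPow'_below (n : ℤ) : LexSupport lexBelow (diffPow' n) := by
  refine lexSupport_lexOf ⟨0, ?_⟩ fun c => ⟨n - c, ?_⟩
  · rintro ⟨a, b⟩ h
    exact diffPow'_eq_zero (Or.inl h)
  · rintro ⟨a, b⟩ h h'
    refine diffPow'_eq_zero (Or.inr ?_)
    change a = c at h
    change b < _ at h'
    dsimp only
    omega

/-- Exponents of `x₁` are at most `n` and determine those of `x₂`. Hence at infinity this expansion
pairs with `Y_W(v, x₂) Y_W(u, x₁)`, opposite to the situation on `V`; this is why the products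
change places in the relation. -/
theorem lexSupport_diffPow_above (n : ℤ) : LexSupport lexAbove (diffPow n) := by
  refine lexSupport_lexOf ⟨-n, ?_⟩ fun c => ⟨-n - c, ?_⟩
  · rintro ⟨a, b⟩ h
    change -a < _ at h
    refine diffPow_eq_zero ?_
    dsimp only
    omega
  · rintro ⟨a, b⟩ h h'
    refine diffPow_eq_zero (Or.inr ?_)
    change -a = c at h
    change -b < _ at h'
    dsimp only
    omega

theorem lexSupport_diffPow'_above (n : ℤ) : LexSupport lexAbove' (diffPow' n) := by
  refine lexSupport_lexOf ⟨-n, ?_⟩ fun c => ⟨-n - c, ?_⟩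
  · rintro ⟨a, b⟩ h
    change -b < _ at h
    refine diffPow'_eq_zero ?_
    dsimp only
    omega
  · rintro ⟨a, b⟩ h h'
    refine diffPow'_eq_zero (Or.inr ?_)
    change -b = c at h
    change -a < _ at h'
    dsimp only
    omega

theorem BoundedBelow.lexSupport {E : Type*} [AddCommGroup E] {S : ℤ → ℤ → E}
    (h : BoundedBelow S) : LexSupport lexBelow S := by
  obtain ⟨N, hN⟩ := h
  exact lexSupport_lexOf ⟨N, fun p hp => hN _ _ (Or.inl hp)⟩
    fun _ => ⟨N, fun p _ hp => hN _ _ (Or.inr hp)⟩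

theorem BoundedAbove.lexSupport {E : Type*} [AddCommGroup E] {S : ℤ → ℤ → E}
    (h : BoundedAbove S) : LexSupport lexAbove S := by
  obtain ⟨N, hN⟩ := h
  refine lexSupport_lexOf ⟨-N, fun p hp => hN _ _ (Or.inl ?_)⟩
    fun _ => ⟨-N, fun p _ hp => hN _ _ (Or.inr ?_)⟩
  · change -p.1 < _ at hp
    omega
  · change -p.2 < _ at hp
    omega

end Orders

/-! ### Expansions at zero and at infinity -/

section RationalFunctions

/-- `g ↦ g(α x + β y)`. -/
def binomSubstₗ (α β : ℂ) : (ℤ → ℂ) →ₗ[ℂ] ℤ → ℤ → ℂ where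
  toFun g := binomSubst g α β
  map_add' g h := by
    funext a b
    simp [binomSubst, add_mul]
  map_smul' c g := by
    funext a b
    simp [binomSubst, mul_assoc]

theorem binomSubst_eq_zero {g : ℤ → ℂ} {α β : ℂ} {a b : ℤ} (h : b < 0 ∨ g (a + b) = 0) :
    binomSubst g α β a b = 0 := by
  rw [binomSubst, binomPow_eq, if_pos rfl]
  obtain h | h := h
  · simp [zchoose_of_neg h]
  · simp [h]

theorem binomSubst_shift {g g' : ℤ → ℂ} (h : ∀ n, g n = g' (n - 1)) {α β : ℂ} (hα : α ≠ 0)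
    (hβ : β ≠ 0) :
    binomSubst g α β = α • shift 1 0 (binomSubst g' α β) + β • shift 0 1 (binomSubst g' α β) := by
  funext a b
  have h1 := congrFun (congrFun (shift_binomPow hα hβ (a + b - 1)) a) b
  rw [sub_add_cancel] at h1
  simp only [binomSubst, h1, h, Pi.add_apply, Pi.smul_apply, shift_apply, smul_eq_mul]
  rw [show a - 1 + (b - 0) = a + b - 1 by ring, show a - 0 + (b - 1) = a + b - 1 by ring]
  ring

theorem binomSubst_one (α β : ℂ) :
    binomSubst (fun n => if n = 0 then 1 else 0) α β = oneSeries := by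
  funext a b
  rw [← binomPow_zero α β, binomSubst]
  split_ifs with h
  · rw [h, one_mul]
  · rw [zero_mul, binomPow_eq, if_neg h]

/-- `atZero` as a linear map. -/
def atZeroₗ : RatFunc ℂ →ₗ[ℂ] ℤ → ℂ where
  toFun := atZero
  map_add' f g := by
    funext n
    simp [atZero]
  map_smul' c f := by
    funext n
    have : ((c • f : RatFunc ℂ) : LaurentSeries ℂ) = HahnSeries.C c * (f : LaurentSeries ℂ) := by
      have h1 := RatFunc.coe_coe (Polynomial.C c)
      rw [Polynomial.coe_C, PowerSeries.coe_C] at h1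
      rw [RatFunc.smul_eq_C_mul, map_mul, ← RatFunc.algebraMap_C, h1]
      rfl
    simp [atZero, this]

/-- `atInfty` as a linear map. -/
def atInftyₗ : RatFunc ℂ →ₗ[ℂ] ℤ → ℂ where
  toFun := atInfty
  map_add' f g := by
    funext n
    simp [atInfty]
  map_smul' c f := by
    funext n
    have : iotaInfty (c • f) = HahnSeries.C c * iotaInfty f := by
      rw [RatFunc.smul_eq_C_mul, map_mul, ← RatFunc.algebraMap_C, iotaInfty,
        RatFunc.liftRingHom_algebraMap]
      simp [polyAtInfty]
    simp [atInfty, this]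

theorem atZero_one : atZero 1 = fun n => if n = 0 then 1 else 0 := by
  funext n
  simp [atZero, HahnSeries.coeff_one]

theorem atInfty_one : atInfty 1 = fun n => if n = 0 then 1 else 0 := by
  funext n
  rw [atInfty, map_one, HahnSeries.coeff_one]
  by_cases h : n = 0
  · rw [if_pos h, if_pos (show OrderDual.toDual n = 0 from h)]
  · rw [if_neg h, if_neg (show ¬OrderDual.toDual n = 0 from h)]

theorem atZero_X_mul (f : RatFunc ℂ) (n : ℤ) : atZero (RatFunc.X * f) n = atZero f (n - 1) := by
  rw [atZero, map_mul, RatFunc.coe_X, HahnSeries.coeff_single_mul, one_mul, atZero]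

theorem atInfty_X_mul (f : RatFunc ℂ) (n : ℤ) :
    atInfty (RatFunc.X * f) n = atInfty f (n - 1) := by
  have : iotaInfty RatFunc.X = HahnSeries.single (OrderDual.toDual (1 : ℤ)) 1 := by
    rw [← RatFunc.algebraMap_X, iotaInfty, RatFunc.liftRingHom_algebraMap]
    simp [polyAtInfty]
  rw [atInfty, map_mul, this, HahnSeries.coeff_single_mul, one_mul, atInfty]
  rfl

theorem exists_forall_lt_eq_zero {Γ E : Type*} [LinearOrder Γ] [Nonempty Γ] [Zero E] {S : Γ → E}
    (h : (Function.support S).IsPWO) : ∃ N, ∀ n < N, S n = 0 := by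
  by_cases hne : (Function.support S).Nonempty
  · refine ⟨h.isWF.min hne, fun n hn => ?_⟩
    by_contra h0
    exact h.isWF.not_lt_min hne h0 hn
  · obtain ⟨x⟩ := ‹Nonempty Γ›
    refine ⟨x, fun n _ => ?_⟩
    by_contra h0
    exact hne ⟨n, h0⟩

/-- `f ↦ ι_{x,0}(f)(x₂ - x₁)`. -/
def expandBelow : RatFunc ℂ →ₗ[ℂ] ℤ → ℤ → ℂ where
  toFun f := swapVars (binomSubst (atZero f) 1 (-1))
  map_add' f g := congrArg swapVars ((binomSubstₗ 1 (-1) ∘ₗ atZeroₗ).map_add f g)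
  map_smul' c f := congrArg swapVars ((binomSubstₗ 1 (-1) ∘ₗ atZeroₗ).map_smul c f)

/-- `f ↦ ι_{x,∞}(f)(-x₁ + x₂)`. -/
def expandAbove : RatFunc ℂ →ₗ[ℂ] ℤ → ℤ → ℂ := binomSubstₗ (-1) 1 ∘ₗ atInftyₗ

theorem isExpansion_expandBelow : IsExpansion lexBelow expandBelow where
  lexSupport f := by
    obtain ⟨N, hN⟩ : ∃ N : ℤ, ∀ n < N, atZero f n = 0 :=
      exists_forall_lt_eq_zero (f : LaurentSeries ℂ).isPWO_support
    refine lexSupport_lexOf ⟨0, ?_⟩ fun c => ⟨N - c, ?_⟩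
    · rintro ⟨a, b⟩ h
      exact binomSubst_eq_zero (Or.inl h)
    · rintro ⟨a, b⟩ h h'
      change a = c at h
      change b < _ at h'
      exact binomSubst_eq_zero (Or.inr (hN _ (by dsimp only; omega)))
  map_one := by
    change swapVars (binomSubst (atZero 1) 1 (-1)) = _
    rw [atZero_one, binomSubst_one]
    funext a b
    simp [swapVars, oneSeries, and_comm]
  map_X_mul f := by
    change swapVars (binomSubst (atZero (RatFunc.X * f)) 1 (-1)) =
      -mulDiff (swapVars (binomSubst (atZero f) 1 (-1)))
    rw [binomSubst_shift (atZero_X_mul f) one_ne_zero (by simp)]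
    funext a b
    simp [swapVars]
    ring

theorem isExpansion_expandAbove : IsExpansion lexAbove expandAbove where
  lexSupport f := by
    obtain ⟨N, hN⟩ : ∃ N : ℤᵒᵈ, ∀ n < N, (iotaInfty f).coeff n = 0 :=
      exists_forall_lt_eq_zero (iotaInfty f).isPWO_support
    have hN' (n : ℤ) (hn : OrderDual.ofDual N < n) : atInfty f n = 0 := hN _ hn
    refine lexSupport_lexOf ⟨-OrderDual.ofDual N, ?_⟩ fun c => ⟨-OrderDual.ofDual N - c, ?_⟩
    · rintro ⟨a, b⟩ h
      change -a < _ at h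
      refine binomSubst_eq_zero ?_
      obtain hb | hb := lt_or_ge b 0
      · exact Or.inl hb
      · exact Or.inr (hN' _ (by dsimp only; omega))
    · rintro ⟨a, b⟩ h h'
      change -a = c at h
      change -b < _ at h'
      exact binomSubst_eq_zero (Or.inr (hN' _ (by dsimp only; omega)))
  map_one := by
    change binomSubst (atInfty 1) (-1) 1 = _
    rw [atInfty_one, binomSubst_one]
  map_X_mul f := by
    change binomSubst (atInfty (RatFunc.X * f)) (-1) 1 = -mulDiff (binomSubst (atInfty f) (-1) 1)
    rw [binomSubst_shift (atInfty_X_mul f) (by simp) one_ne_zero]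
    funext a b
    simp
    ring

end RationalFunctions

/-! ### The algebra and the module-at-infinity as instances -/

section Instances

variable {V : Type*} [AddCommGroup V] [Module ℂ V] (A : NonlocalVertexAlgebra V)

/-- The coefficients of the vertex operators of `V`. -/
def NonlocalVertexAlgebra.coeffs : V →ₗ[ℂ] ℤ → Module.End ℂ V where
  toFun v := (A.Y v).coeff
  map_add' u v := by rw [map_add]; exact map_add HVertexOperator.coeff _ _
  map_smul' c v := by rw [map_smul]; exact map_smul HVertexOperator.coeff _ _

theorem NonlocalVertexAlgebra.exists_coeffs_eq_zero (v w : V) :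
    ∃ N, ∀ n < N, A.coeffs v n w = 0 :=
  exists_forall_lt_eq_zero (HVertexOperator.coeff_isPWOsupport (A.Y v) w)

theorem NonlocalVertexAlgebra.isFieldModule : IsFieldModule A lexBelow' lexBelow A.coeffs where
  vac_left := A.vac_left
  lexSupport_prod12 u v w := by
    refine lexSupport_lexOf ?_ fun c => ?_
    · obtain ⟨N, hN⟩ := A.exists_coeffs_eq_zero v w
      exact ⟨N, fun p hp => by rw [prod12, hN p.2 hp, map_zero]⟩
    · obtain ⟨N, hN⟩ := A.exists_coeffs_eq_zero u (A.coeffs v c w)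
      refine ⟨N, fun p hp hp' => ?_⟩
      change p.2 = c at hp
      rw [prod12, hp, hN p.1 hp']
  lexSupport_prod21 u v w := by
    refine lexSupport_lexOf ?_ fun c => ?_
    · obtain ⟨N, hN⟩ := A.exists_coeffs_eq_zero u w
      exact ⟨N, fun p hp => by rw [prod21, hN p.1 hp, map_zero]⟩
    · obtain ⟨N, hN⟩ := A.exists_coeffs_eq_zero v (A.coeffs u c w)
      refine ⟨N, fun p hp hp' => ?_⟩
      change p.1 = c at hp
      rw [prod21, hp, hN p.2 hp']
  assoc u v := by
    obtain ⟨N, hN⟩ := A.exists_coeffs_eq_zero u v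
    -- The exponent is a bound for the pole of `Y(u, x) v`, so it is independent of `w`, although
    -- `l` in weak associativity is not.
    refine ⟨(-N).toNat, fun w => ?_⟩
    obtain ⟨B, hB⟩ := A.exists_coeffs_eq_zero v w
    obtain ⟨l, hl⟩ := A.weak_assoc u v w
    rw [fmul_binomPow_one_one, fmul_binomPow_one_one] at hl
    have hS : BddSnd B (prod12 (A.coeffs u) (A.coeffs v) w) := fun a b hb => by
      rw [prod12, hB b hb, map_zero]
    obtain ⟨h1, h2⟩ := hS.boundedBelow_and_substTaylor (k := (-N).toNat)
      (T := fun a b => A.coeffs ((A.Y u).coeff a v) b w) (fun a b ha => by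
        have : (A.Y u).coeff a v = 0 := hN a (by omega)
        rw [this, map_zero]
        rfl) hl
    exact ⟨h1.diagFinite, h1.lexSupport, h2⟩

variable {A} {W : Type*} [AddCommGroup W] [Module ℂ W] (M : ModuleAtInfinity A W)

/-- The coefficients of the vertex operators on `W`. -/
def ModuleAtInfinity.coeffs : V →ₗ[ℂ] ℤ → Module.End ℂ W where
  toFun v := (M.Y v).modes
  map_add' u v := by
    funext n
    rw [map_add]
    exact congrFun (map_add HVertexOperator.coeff (M.Y u) (M.Y v)) _
  map_smul' c v := by
    funext n
    rw [map_smul]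
    exact congrFun (map_smul HVertexOperator.coeff c (M.Y v)) _

theorem ModuleAtInfinity.exists_coeffs_eq_zero (v : V) (w : W) :
    ∃ N, ∀ n, -n < N → M.coeffs v n w = 0 := by
  obtain ⟨N, hN⟩ := exists_forall_lt_eq_zero (HVertexOperator.coeff_isPWOsupport (M.Y v) w)
  refine ⟨-OrderDual.ofDual N, fun n hn => hN (OrderDual.toDual n) ?_⟩
  rw [OrderDual.toDual_lt]
  omega

theorem fmul_diffPow_nat {E : Type*} [AddCommGroup E] [Module ℂ E] (k : ℕ) {S : ℤ → ℤ → E}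
    (hS : LexSupport lexAbove' S) :
    fmul (binomPow 1 (-1) k) S = (mulDiff ^ k : Module.End ℂ (ℤ → ℤ → E)) S := by
  change fmul (diffPow k) S = _
  rw [diffPow_eq_diffPow' (by omega), fmul_diffPow'_eq lexSupport_diffPow'_above hS k k, sub_self,
    ← diffPow_eq_diffPow' le_rfl, diffPow, binomPow_zero, fmul_oneSeries]

theorem ModuleAtInfinity.isFieldModule : IsFieldModule A lexAbove' lexAbove M.coeffs := by
  have h12 (u v : V) (w : W) : LexSupport lexAbove' (prod12 (M.coeffs u) (M.coeffs v) w) := by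
    refine lexSupport_lexOf ?_ fun c => ?_
    · obtain ⟨N, hN⟩ := M.exists_coeffs_eq_zero v w
      exact ⟨N, fun p hp => by rw [prod12, hN p.2 hp, map_zero]⟩
    · obtain ⟨N, hN⟩ := M.exists_coeffs_eq_zero u (M.coeffs v (-c) w)
      refine ⟨N, fun p hp hp' => ?_⟩
      change -p.2 = c at hp
      rw [prod12, show p.2 = -c by omega, hN p.1 hp']
  refine ⟨M.vac_left, h12, fun u v w => ?_, fun u v => ?_⟩
  · refine lexSupport_lexOf ?_ fun c => ?_
    · obtain ⟨N, hN⟩ := M.exists_coeffs_eq_zero u w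
      exact ⟨N, fun p hp => by rw [prod21, hN p.1 hp, map_zero]⟩
    · obtain ⟨N, hN⟩ := M.exists_coeffs_eq_zero v (M.coeffs u (-c) w)
      refine ⟨N, fun p hp hp' => ?_⟩
      change -p.1 = c at hp
      rw [prod21, show p.1 = -c by omega, hN p.2 hp']
  · obtain ⟨k, hk⟩ := M.assoc u v
    refine ⟨k, fun w => ?_⟩
    obtain ⟨h1, h2⟩ := hk w
    have h3 := fmul_diffPow_nat k (h12 u v w)
    change fmul (binomPow 1 (-1) k) (prod12 (M.Y u).modes (M.Y v).modes w) = _ at h3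
    rw [h3] at h1 h2
    exact ⟨h1.diagFinite, h1.lexSupport, fun a b => (congrFun (congrFun h2 a) b).symm⟩

end Instances

/-! ### Common denominators and exponents -/

section Main

theorem exists_common_denominator {r : ℕ} (f : Fin r → RatFunc ℂ) :
    ∃ (q : Polynomial ℂ) (p : Fin r → Polynomial ℂ), q ≠ 0 ∧
      ∀ i, algebraMap _ _ q * f i = algebraMap _ _ (p i) := by
  obtain ⟨q, hq⟩ := IsLocalization.exist_integer_multiples_of_finite
    (nonZeroDivisors (Polynomial ℂ)) f
  choose p hp using hq
  refine ⟨q, p, nonZeroDivisors.coe_ne_zero q, fun i => ?_⟩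
  rw [hp i, Algebra.smul_def]

theorem IsFieldModule.exists_assocAt {V : Type*} [AddCommGroup V] [Module ℂ V]
    {A : NonlocalVertexAlgebra V} {E : Type*} [AddCommGroup E] [Module ℂ E]
    {φ ψ : ℤ × ℤ ≃+ ℤ ×ₗ ℤ} {Y : V →ₗ[ℂ] ℤ → Module.End ℂ E} (hY : IsFieldModule A φ ψ Y)
    (u v : V) {r : ℕ} (us vs : Fin r → V) :
    ∃ k, ∀ l, k ≤ l → ∀ w, AssocAt A ψ Y u v l w ∧ ∀ i, AssocAt A ψ Y (vs i) (us i) l w := by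
  obtain ⟨k, hk⟩ := hY.assoc u v
  choose m hm using fun i => hY.assoc (vs i) (us i)
  refine ⟨k + ∑ i, m i, fun l hl w => ⟨(hk w).mono (by omega), fun i => (hm i w).mono ?_⟩⟩
  have := Finset.single_le_sum (f := m) (fun _ _ => Nat.zero_le _) (Finset.mem_univ i)
  omega

end Main

end NLVA

end

theorem proposition4p5 {V : Type*} [AddCommGroup V] [Module ℂ V]
    (A : NLVA.NonlocalVertexAlgebra V)
    {W : Type*} [AddCommGroup W] [Module ℂ W] (M : NLVA.ModuleAtInfinity A W)
    (n : ℤ) (u v : V) (r : ℕ) (us vs : Fin r → V) (f : Fin r → RatFunc ℂ)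
    (s : ℕ) (c : Fin (s + 1) → V) :
    (NLVA.RelationOnAlgebra A n u v us vs f c → NLVA.RelationOnModule M n u v us vs f c) ∧
    (M.Faithful → NLVA.RelationOnModule M n u v us vs f c →
      NLVA.RelationOnAlgebra A n u v us vs f c) := by
  open NLVA in
  obtain ⟨q, p, hq, hp⟩ := exists_common_denominator f
  obtain ⟨k₁, hk₁⟩ := A.isFieldModule.exists_assocAt u v us vs
  obtain ⟨k₂, hk₂⟩ := M.isFieldModule.exists_assocAt u v us vs
  -- One `k` must serve `V` and `W`, since the vectors `skewObstruction A k` depend on it.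
  obtain ⟨k, hkA, hkM⟩ : ∃ k, (∀ w, AssocAt A lexBelow A.coeffs u v k w ∧
      ∀ i, AssocAt A lexBelow A.coeffs (vs i) (us i) k w) ∧
      ∀ w, AssocAt A lexAbove M.coeffs u v k w ∧
        ∀ i, AssocAt A lexAbove M.coeffs (vs i) (us i) k w :=
    ⟨k₁ + k₂, hk₁ _ (by omega), hk₂ _ (by omega)⟩
  have hA (w : V) := relation_iff (n := n) (c := c) lexSupport_diffPow_below
    lexSupport_diffPow'_below (A.isFieldModule.lexSupport_prod12 u v w)
    (A.isFieldModule.lexSupport_braidedProd (us := us) (vs := vs) (f := f)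
      isExpansion_expandBelow) (hkA w).1.1 (hkA w).1.2.2
    (fun t ht => A.isFieldModule.skewObstruction_eq_zero isExpansion_expandBelow (hkA w).1
      (hkA w).2 hp ht)
    (fun h => ⟨rfl, A.isFieldModule.mulDiff_pow_braidedProd isExpansion_expandBelow (hkA w).1
      (hkA w).2 hq hp h⟩)
  -- Here the braided product goes with `(x₁ - x₂)^n`, and `Y_W(u, x₁) Y_W(v, x₂)` with the other
  -- expansion.
  have hM (w : W) := relation_iff (n := n) (c := c) lexSupport_diffPow_above
    lexSupport_diffPow'_above
    (M.isFieldModule.lexSupport_braidedProd (us := us) (vs := vs) (f := f)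
      isExpansion_expandAbove) (M.isFieldModule.lexSupport_prod12 u v w)
    (hkM w).1.1 (hkM w).1.2.2
    (fun t ht => M.isFieldModule.skewObstruction_eq_zero isExpansion_expandAbove (hkM w).1
      (hkM w).2 hp ht.symm)
    (fun h => ⟨M.isFieldModule.mulDiff_pow_braidedProd isExpansion_expandAbove (hkM w).1
      (hkM w).2 hq hp h, rfl⟩)
  constructor
  · intro h w
    -- The vacuum alone detects vectors: the constant term of `Y(y, x) 1` is `y`.
    obtain ⟨h1, h2⟩ := (hA A.vac).1 (h A.vac)
    have h0 (y : V) (hy : ∀ b, A.coeffs y b A.vac = 0) : y = 0 :=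
      (A.creation_lim y).symm.trans (hy 0)
    refine (hM w).2 ⟨fun a b => ?_, fun j b => ?_⟩
    · rw [h0 _ (h1 a), map_zero]
      rfl
    · rw [h0 _ (h2 j), map_zero]
      rfl
  · intro hf h w
    have h0 (y : V) (hy : ∀ w b, M.coeffs y b w = 0) : y = 0 := by
      refine hf ?_
      rw [map_zero]
      refine HVertexOperator.coeff_inj ?_
      funext b
      ext w
      rw [map_zero]
      exact hy w (OrderDual.ofDual b)
    refine (hA w).2 ⟨fun a b => ?_, fun j b => ?_⟩
    · rw [h0 _ fun w => ((hM w).1 (h w)).1 a, map_zero]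
      rfl
    · rw [h0 _ fun w => ((hM w).1 (h w)).2 j, map_zero]
      rfl
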